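/- Let $\mathcal H$ be a complex separable Hilbert space, $L(\mathcal H)$ the algebra of bounded operators on $\mathcal H$ with the operator norm, and $J\in L(\mathcal H)$ with $J=J^*=J^{-1}$. Put $[f,g]=\langle Jf,g\rangle$ and $T^{\#}=JT^*J$ for $T\in L(\mathcal H)$. Let $\mathcal U_J=\{U\in L(\mathcal H): UU^{\#}=U^{\#}U=I\}$ be the group of $J$-unitary operators and let $$\mathcal Q=\{Q\in L(\mathcal H): Q^2=Q,\ QQ^{\#}=Q^{\#}Q\}$$ be the set of $J$-normal projections, on which $\mathcal U_J$ acts by $U\cdot Q=UQU^{\#}$. For a subspace $\mathcal S$ let $\mathcal S^{[\perp]}=\{f: [f,g]=0 \text{ for all } g\in\mathcal S\}$ and $\mathcal S^\circ=\mathcal S\cap\mathcal S^{[\perp]}$. A closed subspace $\mathcal M$ is regular if $\mathcal H=\mathcal M\dotplus\mathcal M^{[\perp]}$, and a closed subspace $\mathcal S$ is pseudo-regular if it is the direct sum of $\mathcal S^\circ$ and a regular subspace; for $Q\in\mathcal Q$ both the range $R(Q)$ and $R(Q)^{[\perp]}$ are pseudo-regular. A pseudo-regular $\mathcal S$ can be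 written as a $J$-orthogonal direct sum $\mathcal S=\mathcal S^\circ[\dotplus]\mathcal M_+[\dotplus]\mathcal M_-$ with $\mathcal M_+$ uniformly $J$-positive ($[f,f]\ge c\|f\|^2$ on $\mathcal M_+$ for some $c>0$), $\mathcal M_-$ uniformly $J$-negative ($[f,f]\le -c\|f\|^2$ on $\mathcal M_-$ for some $c>0$) and $\mathcal M_+[\dotplus]\mathcal M_-$ regular. The positive, negative and isotropic signatures of $\mathcal S$ are $\kappa_\pm(\mathcal S)=\dim\mathcal M_\pm$ and $\kappa_0(\mathcal S)=\dim\mathcal S^\circ$ (elements of $\mathbb N\cup\{\infty\}$, independent of the decomposition), and its positive and negative cosignatures are $c\kappa_\pm(\mathcal S)=\kappa_\pm(\mathcal S^{[\perp]})$. Proposition. Let $Q_0,Q\in\mathcal Q$. The following are equivalent: (i) $Q\in\mathcal U_J\cdot Q_0=\{UQ_0U^{\#}: U\in\mathcal U_J\}$; (ii) $\kappa_+(R(Q))=\kappa_+(R(Q_0))$, $\kappa_-(R(Q))=\kappa_-(R(Q_0))$, $\kappa_0(R(Q))=\kappa_0(R(Q_0))$, $c\kappa_+(R(Q))=c\kappa_+(R(Q_0))$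 and $c\kappa_-(R(Q))=c\kappa_-(R(Q_0))$. Moreover, the connected component of $Q_0$ in $\mathcal Q$ (with the topology of the operator norm) coincides with the orbit $\mathcal U_J\cdot Q_0$. -/

import Mathlib

namespace Krein

variable {H : Type*} [NormedAddCommGroup H] [InnerProductSpace ℂ H]

/-- The indefinite inner product `[f, g] = ⟪J f, g⟫`. -/
noncomputable def form (J : H →L[ℂ] H) (f g : H) : ℂ := inner ℂ (J f) g

/-- The `J`-orthogonal subspace `S^[⊥] = {f | [f, g] = 0 for all g ∈ S}`. -/
def jOrthogonal (J : H →L[ℂ] H) (S : Submodule ℂ H) : Submodule ℂ H where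
  carrier := {f | ∀ g ∈ S, form J f g = 0}
  zero_mem' := by intro g _; simp [form]
  add_mem' := by
    intro a b ha hb g hg
    have h1 : inner ℂ (J a) g = 0 := ha g hg
    have h2 : inner ℂ (J b) g = 0 := hb g hg
    simp [form, h1, h2]
  smul_mem' := by
    intro c a ha g hg
    have h1 : inner ℂ (J a) g = 0 := ha g hg
    simp [form, h1]

/-- The isotropic part `S° = S ∩ S^[⊥]`. -/
def isotropicPart (J : H →L[ℂ] H) (S : Submodule ℂ H) : Submodule ℂ H :=
  S ⊓ jOrthogonal J S

/-- `[f, f] ≥ c ‖f‖²` on `S` for some `c > 0`. -/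
def IsUniformlyPositive (J : H →L[ℂ] H) (S : Submodule ℂ H) : Prop :=
  ∃ c : ℝ, 0 < c ∧ ∀ f ∈ S, c * ‖f‖ ^ 2 ≤ (form J f f).re

/-- `[f, f] ≤ -c ‖f‖²` on `S` for some `c > 0`. -/
def IsUniformlyNegative (J : H →L[ℂ] H) (S : Submodule ℂ H) : Prop :=
  ∃ c : ℝ, 0 < c ∧ ∀ f ∈ S, (form J f f).re ≤ -(c * ‖f‖ ^ 2)

/-- A closed subspace `S` is regular if `H = S [∔] S^[⊥]`. -/
def IsRegular (J : H →L[ℂ] H) (S : Submodule ℂ H) : Prop :=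
  IsClosed (S : Set H) ∧ IsCompl S (jOrthogonal J S)

/-- A decomposition `S = S° [∔] M₊ [∔] M₋` of a (closed) pseudo-regular subspace `S`, where
`M₊` is uniformly `J`-positive, `M₋` is uniformly `J`-negative and `M₊ [∔] M₋` is regular.
(`S°` is `J`-orthogonal to all of `S` by definition.) -/
structure IsSignatureDecomposition (J : H →L[ℂ] H) (S Mpos Mneg : Submodule ℂ H) : Prop where
  isClosed : IsClosed (S : Set H)
  isUniformlyPositive : IsUniformlyPositive J Mpos
  isUniformlyNegative : IsUniformlyNegative J Mneg
  orthogonal : ∀ f ∈ Mpos, ∀ g ∈ Mneg, form J f g = 0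
  disjoint : Disjoint Mpos Mneg
  isRegular : IsRegular J (Mpos ⊔ Mneg)
  disjoint_isotropicPart : Disjoint (isotropicPart J S) (Mpos ⊔ Mneg)
  sup_eq : isotropicPart J S ⊔ (Mpos ⊔ Mneg) = S

/-- The dimension of a subspace, in `ℕ ∪ {∞}`. For a closed subspace of a separable Hilbert space
this is the Hilbert space dimension. -/
noncomputable def dim (S : Submodule ℂ H) : ℕ∞ := Cardinal.toENat (Module.rank ℂ S)

open Classical in
/-- The positive signature `κ₊(S) = dim M₊` of a pseudo-regular subspace, for any decomposition
`S = S° [∔] M₊ [∔] M₋`; see `posSignature_eq` for the independence of the decomposition. -/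
noncomputable def posSignature (J : H →L[ℂ] H) (S : Submodule ℂ H) : ℕ∞ :=
  if h : ∃ M : Submodule ℂ H × Submodule ℂ H, IsSignatureDecomposition J S M.1 M.2 then
    dim h.choose.1 else 0

open Classical in
/-- The negative signature `κ₋(S) = dim M₋` of a pseudo-regular subspace, for any decomposition
`S = S° [∔] M₊ [∔] M₋`; see `negSignature_eq` for the independence of the decomposition. -/
noncomputable def negSignature (J : H →L[ℂ] H) (S : Submodule ℂ H) : ℕ∞ :=
  if h : ∃ M : Submodule ℂ H × Submodule ℂ H, IsSignatureDecomposition J S M.1 M.2 then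
    dim h.choose.2 else 0

/-- The isotropic signature `κ₀(S) = dim S°`. -/
noncomputable def isotropicSignature (J : H →L[ℂ] H) (S : Submodule ℂ H) : ℕ∞ :=
  dim (isotropicPart J S)

/-- The positive cosignature `cκ₊(S) = κ₊(S^[⊥])`. -/
noncomputable def posCosignature (J : H →L[ℂ] H) (S : Submodule ℂ H) : ℕ∞ :=
  posSignature J (jOrthogonal J S)

/-- The negative cosignature `cκ₋(S) = κ₋(S^[⊥])`. -/
noncomputable def negCosignature (J : H →L[ℂ] H) (S : Submodule ℂ H) : ℕ∞ :=
  negSignature J (jOrthogonal J S)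

section Operators

variable [CompleteSpace H]

/-- A fundamental symmetry: `J = J* = J⁻¹`. -/
structure IsFundamentalSymmetry (J : H →L[ℂ] H) : Prop where
  adjoint_eq : ContinuousLinearMap.adjoint J = J
  mul_self : J * J = 1

/-- The `J`-adjoint `T^# = J T* J`. -/
noncomputable def jAdjoint (J T : H →L[ℂ] H) : H →L[ℂ] H :=
  J * ContinuousLinearMap.adjoint T * J

/-- The group `U_J` of bounded `J`-unitary operators. -/
def jUnitary (J : H →L[ℂ] H) : Set (H →L[ℂ] H) :=
  {U | U * jAdjoint J U = 1 ∧ jAdjoint J U * U = 1}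

/-- The set of `J`-normal projections. -/
def jNormalProjections (J : H →L[ℂ] H) : Set (H →L[ℂ] H) :=
  {Q | Q * Q = Q ∧ Q * jAdjoint J Q = jAdjoint J Q * Q}

/-- The orbit `U_J · Q = {U Q U^# | U ∈ U_J}`. -/
def orbit (J Q : H →L[ℂ] H) : Set (H →L[ℂ] H) :=
  {T | ∃ U ∈ jUnitary J, T = U * Q * jAdjoint J U}

end Operators

section WellDefined

theorem rank_le_of_disjoint {S M M' N : Submodule ℂ H} (hS : N ⊔ M' = S) (hM : M ≤ S)
    (hd : Disjoint M N) : Module.rank ℂ M ≤ Module.rank ℂ M' := by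
  have hinj : Function.Injective (N.mkQ.comp M.subtype) := by
    rw [← LinearMap.ker_eq_bot, LinearMap.ker_comp, Submodule.ker_mkQ,
      ← Submodule.disjoint_iff_comap_eq_bot]
    exact hd
  have hle : M.map N.mkQ ≤ M'.map N.mkQ := by
    refine (Submodule.map_mono hM).trans ?_
    rw [← hS, Submodule.map_sup, Submodule.mkQ_map_self, bot_sup_eq]
  have hr : Module.rank ℂ M = Module.rank ℂ (M.map N.mkQ) := by
    rw [← rank_range_of_injective _ hinj, LinearMap.range_comp, Submodule.range_subtype]
  rw [hr]
  exact (Submodule.rank_mono hle).trans (rank_map_le _ _)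

variable [CompleteSpace H]

theorem form_conj_symm {J : H →L[ℂ] H} (hJ : IsFundamentalSymmetry J) (f g : H) :
    form J f g = (starRingEnd ℂ) (form J g f) := by
  unfold form
  rw [inner_conj_symm, ← ContinuousLinearMap.adjoint_inner_right, hJ.adjoint_eq]

/-- On `S° + M`, the form only sees the `M`-component. -/
theorem form_add_isotropic {J : H →L[ℂ] H} (hJ : IsFundamentalSymmetry J) {S : Submodule ℂ H}
    {s m : H} (hs : s ∈ isotropicPart J S) (hm : m ∈ S) :
    form J (s + m) (s + m) = form J m m := by
  have h1 : form J s (s + m) = 0 := hs.2 _ (S.add_mem hs.1 hm)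
  have h2 : form J m s = 0 := by rw [form_conj_symm hJ, hs.2 m hm, map_zero]
  unfold form at *
  rw [map_add, inner_add_left, h1, inner_add_right, h2]
  simp

theorem IsUniformlyPositive.eq_zero {J : H →L[ℂ] H} {M : Submodule ℂ H}
    (h : IsUniformlyPositive J M) {f : H} (hf : f ∈ M) (hn : (form J f f).re ≤ 0) : f = 0 := by
  obtain ⟨c, hc, h⟩ := h
  have h1 : ‖f‖ ^ 2 ≤ 0 := by nlinarith [h f hf, sq_nonneg ‖f‖]
  have h2 : ‖f‖ = 0 := by nlinarith [norm_nonneg f]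
  simpa using h2

theorem IsUniformlyNegative.eq_zero {J : H →L[ℂ] H} {M : Submodule ℂ H}
    (h : IsUniformlyNegative J M) {f : H} (hf : f ∈ M) (hn : 0 ≤ (form J f f).re) : f = 0 := by
  obtain ⟨c, hc, h⟩ := h
  have h1 : ‖f‖ ^ 2 ≤ 0 := by nlinarith [h f hf, sq_nonneg ‖f‖]
  have h2 : ‖f‖ = 0 := by nlinarith [norm_nonneg f]
  simpa using h2

namespace IsSignatureDecomposition

variable {J : H →L[ℂ] H} {S P N P' N' : Submodule ℂ H}

theorem pos_le (h : IsSignatureDecomposition J S P N) : P ≤ S :=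
  (le_sup_left.trans le_sup_right).trans h.sup_eq.le

theorem neg_le (h : IsSignatureDecomposition J S P N) : N ≤ S :=
  (le_sup_right.trans le_sup_right).trans h.sup_eq.le

theorem rank_pos_le (hJ : IsFundamentalSymmetry J) (h : IsSignatureDecomposition J S P N)
    (h' : IsSignatureDecomposition J S P' N') : Module.rank ℂ P ≤ Module.rank ℂ P' := by
  refine rank_le_of_disjoint (N := isotropicPart J S ⊔ N') ?_ h.pos_le ?_
  · rw [sup_assoc, sup_comm N', h'.sup_eq]
  · rw [Submodule.disjoint_def]
    intro x hx hx'
    obtain ⟨s, hs, m, hm, rfl⟩ := Submodule.mem_sup.1 hx'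
    refine h.isUniformlyPositive.eq_zero hx ?_
    rw [form_add_isotropic hJ hs (h'.neg_le hm)]
    obtain ⟨c, hc, hN⟩ := h'.isUniformlyNegative
    have := hN m hm
    have : 0 ≤ c * ‖m‖ ^ 2 := by positivity
    linarith

theorem rank_neg_le (hJ : IsFundamentalSymmetry J) (h : IsSignatureDecomposition J S P N)
    (h' : IsSignatureDecomposition J S P' N') : Module.rank ℂ N ≤ Module.rank ℂ N' := by
  refine rank_le_of_disjoint (N := isotropicPart J S ⊔ P') ?_ h.neg_le ?_
  · rw [sup_assoc, h'.sup_eq]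
  · rw [Submodule.disjoint_def]
    intro x hx hx'
    obtain ⟨s, hs, m, hm, rfl⟩ := Submodule.mem_sup.1 hx'
    refine h.isUniformlyNegative.eq_zero hx ?_
    rw [form_add_isotropic hJ hs (h'.pos_le hm)]
    obtain ⟨c, hc, hP⟩ := h'.isUniformlyPositive
    have := hP m hm
    have : 0 ≤ c * ‖m‖ ^ 2 := by positivity
    linarith

end IsSignatureDecomposition

theorem posSignature_eq {J : H →L[ℂ] H} (hJ : IsFundamentalSymmetry J) {S P N : Submodule ℂ H}
    (h : IsSignatureDecomposition J S P N) : posSignature J S = dim P := by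
  have hex : ∃ M : Submodule ℂ H × Submodule ℂ H, IsSignatureDecomposition J S M.1 M.2 :=
    ⟨(P, N), h⟩
  rw [posSignature, dif_pos hex, dim, dim,
    le_antisymm (hex.choose_spec.rank_pos_le hJ h) (h.rank_pos_le hJ hex.choose_spec)]

theorem negSignature_eq {J : H →L[ℂ] H} (hJ : IsFundamentalSymmetry J) {S P N : Submodule ℂ H}
    (h : IsSignatureDecomposition J S P N) : negSignature J S = dim N := by
  have hex : ∃ M : Submodule ℂ H × Submodule ℂ H, IsSignatureDecomposition J S M.1 M.2 :=
    ⟨(P, N), h⟩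
  rw [negSignature, dif_pos hex, dim, dim,
    le_antisymm (hex.choose_spec.rank_neg_le hJ h) (h.rank_neg_le hJ hex.choose_spec)]

end WellDefined

end Krein

/-!
Write `Q^#` for the `J`-adjoint of a `J`-normal projection `Q`. As `Q` and `Q^#` are commuting
projections, the identity is the sum of the four mutually annihilating projections `Q Q^#`,
`Q (1 - Q^#)`, `Q^# (1 - Q)` and `(1 - Q) (1 - Q^#)`. The range of the first one is a regular
complement of the isotropic part of `R(Q)`, which is the range of the second one, and `R(Q)^[⊥]` is
the range of the `J`-normal projection `1 - Q^#`, so that the cosignatures of `Q` are signatures of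
`1 - Q^#`.

*Normal form.* Averaging the inner product over the group generated by the commuting involutions
`2 Q - 1` and `2 Q^# - 1`, and then replacing `J` by its sign relative to the new inner product,
yields a positive `a` with `(J a)² = 1` for which `Q` is selfadjoint
(`exists_isStrictlyPositive_intertwining`). Such an `a` is the square of a `J`-unitary operator, so
every orbit contains an orthogonal projection (`exists_jUnitary_conj_isSelfAdjoint`). For these the
first and the fourth projection above are orthogonal and commute with `J`, and the eigenspaces of
`J` provide the signature decomposition (`exists_isSignatureDecomposition_of_star_eq`).

*Classification.* A `J`-unitary operator preserves the form, hence all signatures. Conversely, for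
two orthogonal projections with equal signatures and cosignatures, separability provides partial
isometries between corresponding parts, and these add up to a unitary operator commuting with `J`
(`mem_orbit_of_star_eq`).

*Components.* Signatures are locally constant on the `J`-normal projections
(`eventually_sameSignature`), so every orbit is relatively open; orbits being disjoint, a connected
component lies in a single orbit. Orbits are connected because the group of `J`-unitary operators
is path connected: polar decomposition reduces this to a unitary operator commuting with `J`, which
has a square root `w` commuting with `J` and satisfying `‖w - 1‖ < 2` (`exists_unitary_sqrt`). Such
a `w` is the exponential of `i` times a selfadjoint operator commuting with `J`.
-/

namespace Krein

/-! ### Logarithms and intertwining positive elements in C⋆-algebras -/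

section CStarAlgebra

open NormedSpace

variable {A : Type*} [CStarAlgebra A]

theorem exp_mul_exp_neg_self (x : A) : exp x * exp (-x) = 1 := by
  let _ : NormedAlgebra ℚ A := .restrictScalars ℚ ℂ A
  rw [← exp_add_of_commute (Commute.refl x).neg_right, add_neg_cancel, exp_zero]

theorem exp_neg_mul_exp_self (x : A) : exp (-x) * exp x = 1 := by
  simpa using exp_mul_exp_neg_self (-x)

theorem conj_exp {j : A} (hj : j * j = 1) (x : A) : j * exp x * j = exp (j * x * j) :=
  let _ : NormedAlgebra ℚ A := .restrictScalars ℚ ℂ A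
  (exp_units_conj (⟨j, j, hj, hj⟩ : Aˣ) x).symm

variable [PartialOrder A] [StarOrderedRing A]

/-- A positive invertible `a` with `(j a)² = 1` is the exponential of a selfadjoint `x` which
anticommutes with `j`: both `x` and `-(j x j)` are logarithms of `a`. -/
theorem exists_exp_eq {j a : A} (hj : j * j = 1) (hjs : star j = j) (ha : IsStrictlyPositive a)
    (haj : j * a * (j * a) = 1) :
    ∃ x : A, IsSelfAdjoint x ∧ exp x = a ∧ j * x * j = -x := by
  have hx : IsSelfAdjoint (CFC.log a) := IsSelfAdjoint.log
  have he : exp (CFC.log a) = a := CFC.exp_log a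
  refine ⟨CFC.log a, hx, he, ?_⟩
  have h1 : exp (j * CFC.log a * j) = exp (-CFC.log a) := by
    rw [← conj_exp hj, he]
    have h2 : j * a * j * a = 1 := by rw [← haj]; noncomm_ring
    have h3 : a * exp (-CFC.log a) = 1 := by
      conv_lhs => rw [← he, CFC.log_exp _ hx]
      exact exp_mul_exp_neg_self _
    calc j * a * j = j * a * j * (a * exp (-CFC.log a)) := by rw [h3, mul_one]
      _ = exp (-CFC.log a) := by rw [← mul_assoc, h2, one_mul]
  have hxj : IsSelfAdjoint (j * CFC.log a * j) := by
    simpa [hjs] using hx.conjugate j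
  rw [← CFC.log_exp _ hxj, h1, CFC.log_exp _ hx.neg]

/-- If the commuting involutions `s` and `t` are exchanged by the `j`-adjoint, there is a positive
invertible `a` with `(j a)² = 1` for which `s` is selfadjoint with respect to `a`. Averaging over
the group generated by `s` and `t` gives a positive `b ≥ 1` for which both `s` and `t` are
selfadjoint; `a` is the modulus of `j` relative to `b`. -/
theorem exists_isStrictlyPositive_intertwining {j s t : A} (hj : j * j = 1) (hjs : star j = j)
    (hs : s * s = 1) (ht : t * t = 1) (hst : s * t = t * s) (hadj : j * star s * j = t) :
    ∃ a : A, IsStrictlyPositive a ∧ j * a * (j * a) = 1 ∧ star s * a = a * s := by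
  have key {x : A} (hx : x * x = 1) : star x * star x = 1 := by rw [← star_mul, hx, star_one]
  have hst' : star t * star s = star s * star t := by rw [← star_mul, hst, star_mul]
  have ss := key hs
  have tt := key ht
  set b : A := 1 + star s * s + star t * t + star (s * t) * (s * t) with hb
  have hb1 : 1 ≤ b := by
    rw [hb, add_assoc, add_assoc]
    exact le_add_of_nonneg_right
      (add_nonneg (star_mul_self_nonneg _) (add_nonneg (star_mul_self_nonneg _)
        (star_mul_self_nonneg _)))
  have hbpos : IsStrictlyPositive b := .of_le isStrictlyPositive_one hb1
  have reassoc {x y z : A} (h : x * y = z) (w : A) : x * (y * w) = z * w := by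
    rw [← mul_assoc, h]
  have hsb : star s * b = b * s := by
    have h1 : star s * (star t * t) = star t * (star s * t) := by rw [reassoc hst'.symm, mul_assoc]
    simp only [hb, star_mul, mul_add, add_mul, mul_assoc, mul_one, one_mul, hs, reassoc ss,
      reassoc hst'.symm, hst]
    abel
  have htb : star t * b = b * t := by
    simp only [hb, star_mul, mul_add, add_mul, mul_assoc, mul_one, one_mul, ht, reassoc tt]
    abel
  set S := CFC.sqrt b with hS
  have hSpos : IsStrictlyPositive S := hbpos.sqrt
  have hSS : S * S = b := CFC.sqrt_mul_sqrt_self b hbpos.nonneg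
  have hSsa : star S = S := (IsSelfAdjoint.of_nonneg hSpos.nonneg).star_eq
  obtain ⟨R, hSR, hRS⟩ := isUnit_iff_exists.1 hSpos.isUnit
  have hRsa : star R = R := by
    have h1 : star R * S = 1 := by rw [← hSsa, ← star_mul, hSR, star_one]
    calc star R = star R * (S * R) := by rw [hSR, mul_one]
      _ = R := by rw [← mul_assoc, h1, one_mul]
  -- conjugation by `S` makes both involutions selfadjoint
  have sa {x : A} (hx : star x * b = b * x) : R * star x = S * x * R * R := by
    calc R * star x = R * (star x * b) * R * R := by
          rw [← hSS]; simp only [mul_assoc, hSR, mul_one]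
      _ = S * x * R * R := by
          rw [hx, ← hSS]; simp only [mul_assoc, reassoc hRS, one_mul]
  have sa' {x : A} (hx : star x * b = b * x) : star (S * x * R) = S * x * R := by
    rw [star_mul, star_mul, hRsa, hSsa, ← mul_assoc, sa hx, mul_assoc, hRS, mul_one]
  obtain ⟨C, hC⟩ : ∃ x, x = R * j * R := ⟨_, rfl⟩
  obtain ⟨K, hK⟩ : ∃ x, x = S * j * S := ⟨_, rfl⟩
  have hCsa : star C = C := by simp only [hC, star_mul, hRsa, hjs, mul_assoc]
  have hCK : C * K = 1 := by
    simp only [hC, hK, mul_assoc, reassoc hRS, one_mul, reassoc hj, hRS]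
  have hKC : K * C = 1 := by
    simp only [hC, hK, mul_assoc, reassoc hSR, one_mul, reassoc hj, hSR]
  obtain ⟨D, hD⟩ : ∃ x, x = CFC.abs C := ⟨_, rfl⟩
  have hDD : D * D = C * C := by rw [hD, CFC.abs_mul_abs, hCsa]
  have hDC : D * C = C * D := by
    rw [hD]; exact CFC.commute_abs_self C (IsSelfAdjoint.isStarNormal hCsa)
  have hDK : D * K = K * D := by
    calc D * K = K * (C * D) * K := by simp only [← mul_assoc, hKC, one_mul]
      _ = K * D := by rw [← hDC]; simp only [mul_assoc, hCK, mul_one]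
  obtain ⟨s', hs'⟩ : ∃ x, x = S * s * R := ⟨_, rfl⟩
  obtain ⟨t', ht'⟩ : ∃ x, x = S * t * R := ⟨_, rfl⟩
  have hs's : star s' = s' := hs' ▸ sa' hsb
  have ht's : star t' = t' := ht' ▸ sa' htb
  have hjs2 : j * s = star t * j := by
    rw [← hadj]; simp only [star_mul, star_star, hjs, mul_assoc, hj, mul_one]
  have hCs : C * s' = t' * C := by
    calc C * s' = R * (j * s) * R := by
          simp only [hC, hs', mul_assoc, reassoc hRS, one_mul]
      _ = (R * star t) * j * R := by rw [hjs2]; simp only [mul_assoc]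
      _ = t' * C := by rw [sa htb]; simp only [ht', hC, mul_assoc]
  have hsC : s' * C = C * t' := by
    have := congrArg star hCs
    rwa [star_mul, star_mul, hCsa, hs's, ht's] at this
  have hDs : D * s' = s' * D := by
    have hcomm : Commute (star C * C) s' := by
      rw [hCsa]
      change C * C * s' = s' * (C * C)
      rw [mul_assoc, hCs, reassoc hsC, ← mul_assoc, mul_assoc]
    exact hD ▸ hcomm.cfcₙ_nnreal _
  have hDunit : IsUnit D := by
    refine isUnit_iff_exists.2 ⟨D * (K * K), ?_, ?_⟩
    · rw [reassoc hDD, mul_assoc, reassoc hCK, one_mul, hCK]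
    · rw [mul_assoc, mul_assoc, ← hDK, reassoc hDK, mul_assoc, reassoc hDD, mul_assoc C,
        hCK, mul_one, hKC]
  refine ⟨S * D * S, ⟨?_, (hSpos.isUnit.mul hDunit).mul hSpos.isUnit⟩, ?_, ?_⟩
  · simpa [hSsa] using star_left_conjugate_nonneg (hD ▸ CFC.abs_nonneg C) S
  · calc j * (S * D * S) * (j * (S * D * S)) = R * (K * D * (K * D)) * S := by
          simp only [hK, mul_assoc, reassoc hRS, one_mul]
      _ = R * (K * (D * K) * D) * S := by simp only [mul_assoc]
      _ = 1 := by
          rw [hDK]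
          simp only [mul_assoc, reassoc hDD, reassoc hKC, one_mul, hRS]
  · calc star s * (S * D * S) = S * (R * star s) * S * D * S := by
          simp only [mul_assoc, reassoc hSR, one_mul]
      _ = S * (s' * D) * S := by
          rw [sa hsb]; simp only [hs', mul_assoc, reassoc hRS, one_mul]
      _ = S * D * S * s := by
          rw [← hDs]; simp only [hs', mul_assoc, hRS, mul_one]

end CStarAlgebra

/-! ### Square roots of unitary operators -/

section Unitary

variable {H : Type*} [NormedAddCommGroup H] [InnerProductSpace ℂ H]

theorem eq_of_mul_eq_mul_of_denseRange {a b e : H →L[ℂ] H} (he : DenseRange e)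
    (h : a * e = b * e) : a = b := by
  ext y
  refine congrFun (he.equalizer a.continuous b.continuous (funext fun x => ?_)) y
  exact congrArg (fun T : H →L[ℂ] H => T x) h

variable [CompleteSpace H]

theorem denseRange_of_star_eq_of_injective {e : H →L[ℂ] H} (hs : star e = e)
    (he : Function.Injective e) : DenseRange e := by
  have h : e.rangeᗮ = ⊥ := by
    rw [ContinuousLinearMap.orthogonal_range, ← ContinuousLinearMap.star_eq_adjoint, hs]
    exact LinearMap.ker_eq_bot.2 he
  have := Submodule.dense_iff_topologicalClosure_eq_top.2
    (Submodule.topologicalClosure_eq_top_iff.2 h)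
  exact this

open ContinuousLinearMap in
/-- A unitary operator `u` has a unitary square root `w` with nonnegative real part. Up to the
kernel of `1 + u`, it is the unitary factor of the polar decomposition of `1 + u`, because
`(1 + z) / |1 + z|` is a square root of `z` on the unit circle; on that kernel it is `i`. -/
theorem exists_unitary_sqrt {u : H →L[ℂ] H} (hu : star u * u = 1) (hu' : u * star u = 1) :
    ∃ w : H →L[ℂ] H, star w * w = 1 ∧ w * star w = 1 ∧ w * w = u ∧ ‖w - 1‖ < 2 ∧
      ∀ j : H →L[ℂ] H, star j = j → j * u = u * j → j * w = w * j := by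
  obtain ⟨T, hT⟩ : ∃ x : H →L[ℂ] H, x = 1 + u := ⟨_, rfl⟩
  have hTT : star T * T = T + star T := by
    simp only [hT, star_add, star_one, mul_add, add_mul, hu, one_mul, mul_one]; abel
  have hTT' : T * star T = T + star T := by
    simp only [hT, star_add, star_one, mul_add, add_mul, hu', one_mul, mul_one]; abel
  have hTn : IsStarNormal T := ⟨hTT.trans hTT'.symm⟩
  have : CompleteSpace T.ker := T.isClosed_ker.completeSpace_coe
  obtain ⟨P, hP⟩ : ∃ x : H →L[ℂ] H, x = T.ker.starProjection := ⟨_, rfl⟩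
  have hPproj : IsStarProjection P := hP ▸ isStarProjection_starProjection
  have hPs : star P = P := hPproj.isSelfAdjoint.star_eq
  have hPP : P * P = P := hPproj.isIdempotentElem.eq
  have hTP : T * P = 0 := by
    ext x
    rw [hP]
    exact (Submodule.starProjection_apply_mem T.ker x : _)
  have hPX {X : H →L[ℂ] H} (h : T * X = 0) : P * X = X := by
    ext x
    rw [hP]
    refine Submodule.starProjection_eq_self_iff.2 ?_
    exact congrArg (fun S : H →L[ℂ] H => S x) h
  have app (a b : H →L[ℂ] H) (x : H) : (a * b) x = a (b x) := rfl
  have hII : Complex.I • Complex.I • P = -P := by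
    ext x
    change Complex.I • Complex.I • P x = -P x
    rw [smul_smul, Complex.I_mul_I, neg_one_smul]
  have huP : u * P = -P := by
    rw [hT, add_mul, one_mul] at hTP
    exact (neg_eq_of_add_eq_zero_right hTP).symm
  have hPu : P * u = -P := by
    have h1 : P * star u = -P := by simpa [hPs] using congrArg star huP
    calc P * u = -(P * star u) * u := by rw [h1, neg_neg]
      _ = -P := by rw [neg_mul, mul_assoc, hu, mul_one]
  have hPT : P * T = 0 := by rw [hT, mul_add, hPu, mul_one, add_neg_cancel]
  obtain ⟨B, hB⟩ : ∃ x : H →L[ℂ] H, x = CFC.abs T := ⟨_, rfl⟩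
  have hBB : B * B = star T * T := by rw [hB]; exact CFC.abs_mul_abs T
  have hB0 : 0 ≤ B := hB ▸ CFC.abs_nonneg T
  have hBs : star B = B := (IsSelfAdjoint.of_nonneg hB0).star_eq
  have hBT : B * T = T * B := by rw [hB]; exact CFC.commute_abs_self T hTn
  have hBP : B * P = 0 := by
    rw [← CStarRing.star_mul_self_eq_zero_iff, star_mul, hBs, mul_assoc, ← mul_assoc B, hBB,
      mul_assoc (star T), hTP, mul_zero, mul_zero]
  have hPB : P * B = 0 := by simpa [hPs, hBs] using congrArg star hBP
  have hTsP : star T * P = 0 := by simpa [hPs] using congrArg star hPT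
  -- on the range of `e`, which is dense, the square root `w` is determined by `w e = f`
  obtain ⟨e, he⟩ : ∃ x : H →L[ℂ] H, x = B + P := ⟨_, rfl⟩
  obtain ⟨f, hf⟩ : ∃ x : H →L[ℂ] H, x = T + Complex.I • P := ⟨_, rfl⟩
  have hes : star e = e := by rw [he, star_add, hBs, hPs]
  have hee : e * e = B * B + P := by
    simp only [he, mul_add, add_mul, hBP, hPB, hPP]; abel
  have hef : e * f = B * T + Complex.I • P := by
    simp [he, hf, mul_add, add_mul, hBP, hPT, hPP]
  have hfe : f * e = B * T + Complex.I • P := by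
    simp only [he, hf, mul_add, add_mul, smul_mul_assoc, hPB, hTP, hPP, smul_zero, hBT]; abel
  have hff : star f * f = e * e := by
    simp only [hee, hBB, hf, star_add, star_smul, mul_add, add_mul, smul_mul_assoc, mul_smul_comm,
      hPT, hTsP, hPs, hPP, smul_zero]
    simp [hII]
  have hff' : f * f = u * (e * e) := by
    have h1 : T * T = u * (B * B) := by
      rw [hBB, hTT, hT, star_add, star_one]
      simp only [mul_add, add_mul, mul_one, one_mul, hu']
      abel
    simp only [hee, mul_add, huP, ← h1, hf, add_mul, smul_mul_assoc, mul_smul_comm, hPT, hTP, hPP,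
      smul_zero]
    simp [hII]
  have hnorm (x : H) : ‖f x‖ = ‖e x‖ := by
    have h1 : ‖f x‖ ^ 2 = ‖e x‖ ^ 2 := by
      have a1 := apply_norm_sq_eq_inner_adjoint_left f x
      have a2 := apply_norm_sq_eq_inner_adjoint_left e x
      rw [a1, a2]
      change RCLike.re (inner ℂ ((star f * f) x) x) = RCLike.re (inner ℂ ((star e * e) x) x)
      rw [hff, hes]
    exact (pow_left_inj₀ (norm_nonneg _) (norm_nonneg _) two_ne_zero).1 h1
  have hinj : Function.Injective e := by
    refine (injective_iff_map_eq_zero e).2 fun x hx => ?_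
    have h1 : P x = 0 := by
      have : (P * e) x = P x := by rw [he, mul_add, hPB, hPP, zero_add]
      rw [← this, app, hx, map_zero]
    have h2 : f x = 0 := by rw [← norm_eq_zero, hnorm, hx, norm_zero]
    have h3 : T x = 0 := by simpa [hf, h1] using h2
    rw [← h1, hP]
    exact (Submodule.starProjection_eq_self_iff.2 h3).symm
  have hdense : DenseRange e := denseRange_of_star_eq_of_injective hes hinj
  have hdense2 : DenseRange (e * e) := hdense.comp hdense e.continuous
  obtain ⟨w, hw⟩ : ∃ x : H →L[ℂ] H, x = f.toLinearMap.extendOfNorm e.toLinearMap := ⟨_, rfl⟩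
  have hwe : w * e = f := by
    ext x
    rw [hw]
    exact LinearMap.extendOfNorm_eq hdense ⟨1, fun x => (hnorm x).le.trans (one_mul _).ge⟩ x
  have hwn (y : H) : ‖w y‖ = ‖y‖ := by
    refine hdense.induction_on (p := fun y => ‖w y‖ = ‖y‖) y
      (isClosed_eq (by fun_prop) (by fun_prop)) fun x => ?_
    rw [← app, hwe, hnorm]
  have hww : star w * w = 1 := (norm_map_iff_adjoint_comp_self w).1 hwn
  have hwu : w * w = u := by
    refine eq_of_mul_eq_mul_of_denseRange hdense2 ?_
    calc w * w * (e * e) = w * (w * e) * e := by simp only [mul_assoc]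
      _ = w * e * f := by rw [hwe, mul_assoc, hfe, ← hef, ← mul_assoc, hwe]
      _ = u * (e * e) := by rw [hwe, hff']
  have hws : star w = w * star u := by
    calc star w = star w * (w * w * star u) := by rw [hwu, hu', mul_one]
      _ = w * star u := by simp only [← mul_assoc, hww, one_mul]
  have hwpos (y : H) : 0 ≤ RCLike.re (inner ℂ y (w y)) := by
    refine hdense.induction_on (p := fun y => 0 ≤ RCLike.re (inner ℂ y (w y))) y
      (isClosed_le (by fun_prop) (by fun_prop)) fun x => ?_
    have h1 : inner ℂ (e x) (w (e x)) = inner ℂ x ((B * T) x) + Complex.I * inner ℂ x (P x) := by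
      rw [← app w, hwe, ← adjoint_inner_right, ← star_eq_adjoint, hes, ← app, hef]
      change inner ℂ x ((B * T) x + Complex.I • P x) = _
      rw [inner_add_right, inner_smul_right]
    have h2 : (inner ℂ x (P x)).im = 0 := by
      have : (inner ℂ x (P x)) = inner ℂ (P x) (P x) := by
        conv_lhs => rw [← hPP, app, ← adjoint_inner_left, ← star_eq_adjoint, hPs]
      rw [this]; exact inner_self_im (𝕜 := ℂ) _
    have h3 : 2 * RCLike.re (inner ℂ x ((B * T) x)) = RCLike.re (inner ℂ (B x) (B (B x))) := by
      have h4 : RCLike.re (inner ℂ x ((B * T) x)) = RCLike.re (inner ℂ x (star (B * T) x)) := by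
        rw [star_eq_adjoint, adjoint_inner_right, ← inner_conj_symm, RCLike.conj_re]
      have h5 : B * T + star (B * T) = B * (B * B) := by
        rw [star_mul, hBs, hBB, hTT, mul_add]
        congr 1
        have := congrArg star hBT
        simpa [hBs] using this
      calc _ = RCLike.re (inner ℂ x ((B * T + star (B * T)) x)) := by
            rw [two_mul, add_apply, inner_add_right, map_add, ← h4]
        _ = _ := by
            rw [h5]
            conv_rhs => rw [← adjoint_inner_right, ← star_eq_adjoint, hBs]
            rfl
    have h6 : 0 ≤ RCLike.re (inner ℂ (B x) (B (B x))) :=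
      ((nonneg_iff_isPositive B).1 hB0).re_inner_nonneg_right _
    have h7 : RCLike.re (Complex.I * inner ℂ x (P x)) = 0 := by simp [h2]
    rw [h1, map_add, h7]
    linarith
  refine ⟨w, hww, ?_, hwu, ?_, ?_⟩
  · rw [hws, ← mul_assoc, hwu, hu']
  · have hle : ‖w - 1‖ ≤ √2 := by
      refine opNorm_le_bound _ (Real.sqrt_nonneg _) fun y => ?_
      rw [← Real.sqrt_sq (norm_nonneg y), ← Real.sqrt_mul zero_le_two]
      refine Real.le_sqrt_of_sq_le ?_
      have h1 : ‖w y - y‖ ^ 2 = _ := norm_sub_rev (w y) y ▸ norm_sub_sq (𝕜 := ℂ) y (w y)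
      have := hwpos y
      rw [hwn] at h1
      change ‖w y - y‖ ^ 2 ≤ _
      linarith
    exact hle.trans_lt (by rw [Real.sqrt_lt' two_pos]; norm_num)
  · intro j hj hju
    have hjT : j * T = T * j := by rw [hT, mul_add, add_mul, hju, mul_one, one_mul]
    have hjB : j * B = B * j := by
      have := (Commute.cfcAbs_left (a := T) (b := j) hjT.symm (hj.symm ▸ hjT.symm : _)).eq
      rw [hB, this]
    have hjP : j * P = P * j := by
      have h1 : P * (j * P) = j * P := hPX (by rw [← mul_assoc, ← hjT, mul_assoc, hTP, mul_zero])
      have h2 := congrArg star h1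
      rw [star_mul, star_mul, hPs, hj] at h2
      rw [← h1, ← mul_assoc, h2]
    refine eq_of_mul_eq_mul_of_denseRange hdense ?_
    have hje : j * e = e * j := by rw [he, mul_add, add_mul, hjB, hjP]
    rw [mul_assoc, hwe, mul_assoc, hje, ← mul_assoc, hwe, hf, mul_add, add_mul, hjT,
      mul_smul_comm, hjP, smul_mul_assoc]

end Unitary

/-! ### The group of `J`-unitary operators and the normal form -/

section JUnitary

open NormedSpace ContinuousLinearMap

variable {H : Type*} [NormedAddCommGroup H] [InnerProductSpace ℂ H] [CompleteSpace H]
  {J : H →L[ℂ] H}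

theorem IsFundamentalSymmetry.star_eq (hJ : IsFundamentalSymmetry J) : star J = J :=
  hJ.adjoint_eq

theorem jAdjoint_eq (J T : H →L[ℂ] H) : jAdjoint J T = J * star T * J := rfl

theorem continuous_jAdjoint (J : H →L[ℂ] H) : Continuous (jAdjoint J) := by
  simp only [funext (jAdjoint_eq J)]; fun_prop

theorem jAdjoint_sub (J S T : H →L[ℂ] H) :
    jAdjoint J (S - T) = jAdjoint J S - jAdjoint J T := by
  simp only [jAdjoint_eq, star_sub, mul_sub, sub_mul]

theorem jAdjoint_one (hJ : IsFundamentalSymmetry J) : jAdjoint J 1 = 1 := by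
  rw [jAdjoint_eq, star_one, mul_one, hJ.mul_self]

theorem mul_mul_cancel (hJ : IsFundamentalSymmetry J) (T : H →L[ℂ] H) : J * (J * T) = T := by
  rw [← mul_assoc, hJ.mul_self, one_mul]

theorem jAdjoint_mul (hJ : IsFundamentalSymmetry J) (S T : H →L[ℂ] H) :
    jAdjoint J (S * T) = jAdjoint J T * jAdjoint J S := by
  simp only [jAdjoint_eq, star_mul, mul_assoc, mul_mul_cancel hJ]

theorem jAdjoint_jAdjoint (hJ : IsFundamentalSymmetry J) (T : H →L[ℂ] H) :
    jAdjoint J (jAdjoint J T) = T := by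
  simp only [jAdjoint_eq, star_mul, star_star, hJ.star_eq, mul_assoc, mul_mul_cancel hJ,
    hJ.mul_self, mul_one]

theorem mul_mem_jUnitary (hJ : IsFundamentalSymmetry J) {U V : H →L[ℂ] H} (hU : U ∈ jUnitary J)
    (hV : V ∈ jUnitary J) : U * V ∈ jUnitary J := by
  constructor
  · rw [jAdjoint_mul hJ, mul_assoc, ← mul_assoc V, hV.1, one_mul, hU.1]
  · rw [jAdjoint_mul hJ, mul_assoc, ← mul_assoc (jAdjoint J U), hU.2, one_mul, hV.2]

theorem one_mem_jUnitary (hJ : IsFundamentalSymmetry J) : 1 ∈ jUnitary J := by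
  constructor <;> rw [jAdjoint_one hJ, one_mul]

theorem jAdjoint_mem_jUnitary (hJ : IsFundamentalSymmetry J) {U : H →L[ℂ] H}
    (hU : U ∈ jUnitary J) : jAdjoint J U ∈ jUnitary J := by
  constructor <;> rw [jAdjoint_jAdjoint hJ]
  exacts [hU.2, hU.1]

theorem jAdjoint_exp (hJ : IsFundamentalSymmetry J) (Y : H →L[ℂ] H) :
    jAdjoint J (exp Y) = exp (jAdjoint J Y) := by
  rw [jAdjoint_eq, star_exp, conj_exp hJ.mul_self, jAdjoint_eq]

theorem exp_mem_jUnitary (hJ : IsFundamentalSymmetry J) {Y : H →L[ℂ] H}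
    (hY : jAdjoint J Y = -Y) : exp Y ∈ jUnitary J := by
  constructor <;> rw [jAdjoint_exp hJ, hY]
  exacts [exp_mul_exp_neg_self Y, exp_neg_mul_exp_self Y]

theorem jAdjoint_real_smul (c : ℝ) (Y : H →L[ℂ] H) : jAdjoint J (c • Y) = c • jAdjoint J Y := by
  simp [jAdjoint_eq, star_smul]

theorem exp_half_mul_self (Y : H →L[ℂ] H) : exp ((2⁻¹ : ℝ) • Y) * exp ((2⁻¹ : ℝ) • Y) = exp Y := by
  let _ : NormedAlgebra ℚ (H →L[ℂ] H) := .restrictScalars ℚ ℂ (H →L[ℂ] H)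
  rw [← exp_add_of_commute (Commute.refl _), ← add_smul]
  norm_num

/-- Polar decomposition of a `J`-unitary operator, with logarithms of both factors in the Lie
algebra of the group of `J`-unitary operators. -/
theorem exists_eq_exp_mul_exp (hJ : IsFundamentalSymmetry J) {U : H →L[ℂ] H}
    (hU : U ∈ jUnitary J) :
    ∃ Y Z : H →L[ℂ] H, jAdjoint J Y = -Y ∧ jAdjoint J Z = -Z ∧ U = exp Y * exp Z := by
  have h1 : star U * J * U = J := by
    have := hU.2
    rw [jAdjoint_eq] at this
    calc star U * J * U = J * (J * star U * J * U) := by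
          simp only [mul_assoc, mul_mul_cancel hJ]
      _ = J := by rw [this, mul_one]
  have h2 : U * J * star U = J := by
    have := hU.1
    rw [jAdjoint_eq] at this
    calc U * J * star U = U * (J * star U * J) * J := by
          simp only [mul_assoc, hJ.mul_self, mul_one]
      _ = J := by rw [this, one_mul]
  have hunit : IsUnit U := isUnit_iff_exists.2 ⟨_, hU.1, hU.2⟩
  obtain ⟨X, hX, hXA, hJX⟩ := exists_exp_eq hJ.mul_self hJ.star_eq
    (a := star U * U) ⟨star_mul_self_nonneg U, hunit.star.mul hunit⟩ (by
      calc J * (star U * U) * (J * (star U * U)) = J * (star U * (U * J * star U) * U) := by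
            simp only [mul_assoc]
        _ = 1 := by rw [h2, h1, hJ.mul_self])
  set V := exp ((2⁻¹ : ℝ) • X) with hV
  set R := exp (-((2⁻¹ : ℝ) • X)) with hR
  have hVV : V * V = star U * U := by rw [hV, exp_half_mul_self, hXA]
  have hVR : V * R = 1 := exp_mul_exp_neg_self _
  have hRV : R * V = 1 := exp_neg_mul_exp_self _
  have hRs : star R = R := by
    rw [hR, star_exp, star_neg, star_smul, hX.star_eq]; simp
  have hJR : J * R = V * J := by
    have : J * R * J = V := by
      rw [hR, hV, conj_exp hJ.mul_self]
      congr 1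
      rw [mul_neg, mul_smul_comm, neg_mul, smul_mul_assoc, hJX, smul_neg, neg_neg]
    rw [← this, mul_assoc _ J J, hJ.mul_self, mul_one]
  -- the unitary factor of the polar decomposition of `U`; it commutes with `J`
  set W := U * R with hW
  have hWW : star W * W = 1 := by
    calc star W * W = R * (star U * U) * R := by rw [hW, star_mul, hRs]; simp only [mul_assoc]
      _ = 1 := by rw [← hVV, ← mul_assoc, hRV, one_mul, hVR]
  have hWJW : W * J * star W = J := by
    calc W * J * star W = U * R * (J * R) * star U := by
          rw [hW, star_mul, hRs]; simp only [mul_assoc]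
      _ = U * (R * V) * J * star U := by rw [hJR]; simp only [mul_assoc]
      _ = J := by rw [hRV, mul_one, h2]
  have hJW : J * W = W * J := by
    conv_lhs => rw [← hWJW]
    rw [mul_assoc, hWW, mul_one]
  have hWW' : W * star W = 1 := by
    have hJW' : star W * J = J * star W := by
      simpa only [star_mul, hJ.star_eq] using congrArg star hJW
    calc W * star W = W * J * star W * J := by
          rw [mul_assoc (W * J), hJW', mul_assoc W J, mul_mul_cancel hJ]
      _ = 1 := by rw [hWJW, hJ.mul_self]
  obtain ⟨w, hw1, hw2, hwW, hwn, hwJ⟩ := exists_unitary_sqrt hWW hWW'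
  set w' : unitary (H →L[ℂ] H) := ⟨w, Unitary.mem_iff.2 ⟨hw1, hw2⟩⟩ with hw'
  set h := (Unitary.argSelfAdjoint w').1 with hh
  have hexp : exp (Complex.I • h) = w :=
    congrArg Subtype.val (expUnitary_argSelfAdjoint (u := w') hwn)
  have hJh : h * J = J * h := by
    have e1 := hwJ J hJ.star_eq hJW
    have e2 : star w * J = J * star w := by simpa [hJ.star_eq] using congrArg star e1
    exact Commute.cfc (e1.symm : Commute w J) e2 _
  have hhs : star h = h := (Unitary.argSelfAdjoint w').2
  have hh' : jAdjoint J (Complex.I • h) = -(Complex.I • h) := by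
    rw [jAdjoint_eq, star_smul, hhs, mul_smul_comm, ← hJh, smul_mul_assoc, mul_assoc, hJ.mul_self,
      mul_one]
    simp
  have hXs : jAdjoint J X = -X := by rw [jAdjoint_eq, hX.star_eq, hJX]
  refine ⟨Complex.I • h + Complex.I • h, (2⁻¹ : ℝ) • X, ?_, ?_, ?_⟩
  · have : jAdjoint J (Complex.I • h + Complex.I • h)
        = jAdjoint J (Complex.I • h) + jAdjoint J (Complex.I • h) := by
      simp only [jAdjoint_eq, star_add, mul_add, add_mul]
    rw [this, hh', neg_add]
  · rw [jAdjoint_real_smul, hXs, smul_neg]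
  · let _ : NormedAlgebra ℚ (H →L[ℂ] H) := .restrictScalars ℚ ℂ (H →L[ℂ] H)
    rw [exp_add_of_commute (Commute.refl _), hexp, hwW, hW, mul_assoc, hRV, mul_one]

/-- The group of `J`-unitary operators is path connected. -/
theorem exists_path_jUnitary (hJ : IsFundamentalSymmetry J) {U : H →L[ℂ] H}
    (hU : U ∈ jUnitary J) :
    ∃ γ : ℝ → H →L[ℂ] H, Continuous γ ∧ (∀ t, γ t ∈ jUnitary J) ∧ γ 0 = 1 ∧ γ 1 = U := by
  obtain ⟨Y, Z, hY, hZ, rfl⟩ := exists_eq_exp_mul_exp hJ hU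
  let _ : NormedAlgebra ℚ (H →L[ℂ] H) := .restrictScalars ℚ ℂ (H →L[ℂ] H)
  refine ⟨fun t => exp (t • Y) * exp (t • Z), ?_, fun t => mul_mem_jUnitary hJ
    (exp_mem_jUnitary hJ ?_) (exp_mem_jUnitary hJ ?_), by simp, by simp⟩
  · exact (exp_continuous.comp (by fun_prop)).mul (exp_continuous.comp (by fun_prop))
  · rw [jAdjoint_real_smul, hY, smul_neg]
  · rw [jAdjoint_real_smul, hZ, smul_neg]

/-- Every `J`-normal projection is `J`-unitarily equivalent to an orthogonal projection. -/
theorem exists_jUnitary_conj_isSelfAdjoint (hJ : IsFundamentalSymmetry J) {Q : H →L[ℂ] H}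
    (hQ : Q ∈ jNormalProjections J) :
    ∃ U ∈ jUnitary J, star (U * Q * jAdjoint J U) = U * Q * jAdjoint J U := by
  obtain ⟨hQ1, hQ2⟩ := hQ
  have inv {P : H →L[ℂ] H} (hP : P * P = P) : (P + P - 1) * (P + P - 1) = 1 := by
    simp only [mul_sub, mul_add, sub_mul, add_mul, hP, mul_one, one_mul]; abel
  have hQ1' : jAdjoint J Q * jAdjoint J Q = jAdjoint J Q := by rw [← jAdjoint_mul hJ, hQ1]
  obtain ⟨a, ha, haJ, hQa⟩ := exists_isStrictlyPositive_intertwining (s := Q + Q - 1)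
    (t := jAdjoint J Q + jAdjoint J Q - 1) hJ.mul_self hJ.star_eq (inv hQ1) (inv hQ1')
    (by simp only [mul_sub, mul_add, sub_mul, add_mul, hQ2, mul_one, one_mul]; abel)
    (by simp only [jAdjoint_eq, star_sub, star_add, star_one, mul_sub, mul_add, sub_mul, add_mul,
          mul_one, hJ.mul_self])
  have hQa' : star Q * a = a * Q := by
    have : (2 : ℂ) • (star Q * a) = (2 : ℂ) • (a * Q) := by
      rw [two_smul, two_smul]
      simpa [mul_sub, mul_add, sub_mul, add_mul] using hQa
    exact smul_right_injective _ two_ne_zero this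
  obtain ⟨X, hX, hXa, hJX⟩ := exists_exp_eq hJ.mul_self hJ.star_eq ha haJ
  set V := exp ((2⁻¹ : ℝ) • X) with hV
  set R := exp (-((2⁻¹ : ℝ) • X)) with hR
  have hVV : V * V = a := by rw [hV, exp_half_mul_self, hXa]
  have hVR : V * R = 1 := exp_mul_exp_neg_self _
  have hRV : R * V = 1 := exp_neg_mul_exp_self _
  have hX' : jAdjoint J ((2⁻¹ : ℝ) • X) = -((2⁻¹ : ℝ) • X) := by
    rw [jAdjoint_real_smul, jAdjoint_eq, hX.star_eq, hJX, smul_neg]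
  have hVs : star V = V := by rw [hV, star_exp, star_smul, hX.star_eq]; simp
  have hRs : star R = R := by rw [hR, star_exp, star_neg, star_smul, hX.star_eq]; simp
  refine ⟨V, exp_mem_jUnitary hJ hX', ?_⟩
  have hVa : jAdjoint J V = R := by rw [hV, jAdjoint_exp hJ, hX']
  rw [hVa, star_mul, star_mul, hVs, hRs]
  calc R * (star Q * V) = R * (star Q * (V * V)) * R := by
        simp only [mul_assoc, hVR, mul_one]
    _ = R * V * V * Q * R := by rw [hVV, hQa', ← hVV]; simp only [mul_assoc]
    _ = V * Q * R := by rw [hRV, one_mul]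

end JUnitary

/-! ### Signatures -/

section Signature

variable {H : Type*} [NormedAddCommGroup H] [InnerProductSpace ℂ H]
  {J : H →L[ℂ] H}

theorem mem_range_iff_of_mul_self {T : H →L[ℂ] H} (hT : T * T = T) {x : H} :
    x ∈ T.range ↔ T x = x :=
  ⟨by rintro ⟨y, rfl⟩; exact congrArg (fun S : H →L[ℂ] H => S y) hT, fun h => ⟨x, h⟩⟩

theorem isClosed_range_of_mul_self {T : H →L[ℂ] H} (hT : T * T = T) :
    IsClosed (T.range : Set H) := by
  have : (T.range : Set H) = {x | T x = x} := Set.ext fun x => mem_range_iff_of_mul_self hT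
  rw [this]
  exact isClosed_eq T.continuous continuous_id

variable [CompleteSpace H]

theorem mem_jOrthogonal_range_iff (hJ : IsFundamentalSymmetry J) {T : H →L[ℂ] H} {x : H} :
    x ∈ jOrthogonal J T.range ↔ jAdjoint J T x = 0 := by
  have h1 (y : H) : form J x (T y) = inner ℂ (ContinuousLinearMap.adjoint T (J x)) y :=
    (ContinuousLinearMap.adjoint_inner_left T y (J x)).symm
  have h2 : jAdjoint J T x = J (ContinuousLinearMap.adjoint T (J x)) := rfl
  have h3 (y : H) (hy : J y = 0) : y = 0 := by
    have : J (J y) = y := congrArg (fun S : H →L[ℂ] H => S y) hJ.mul_self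
    rw [← this, hy, map_zero]
  constructor
  · intro h
    have h4 := h (T (ContinuousLinearMap.adjoint T (J x))) ⟨_, rfl⟩
    rw [h2, inner_self_eq_zero.1 ((h1 _).symm.trans h4), map_zero]
  · rintro h _ ⟨y, rfl⟩
    rw [h2] at h
    exact (h1 y).trans (by rw [h3 _ h, inner_zero_left])

theorem one_sub_jAdjoint_mem (hJ : IsFundamentalSymmetry J) {Q : H →L[ℂ] H}
    (hQ : Q ∈ jNormalProjections J) : 1 - jAdjoint J Q ∈ jNormalProjections J := by
  have h : jAdjoint J Q * jAdjoint J Q = jAdjoint J Q := by rw [← jAdjoint_mul hJ, hQ.1]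
  constructor
  · simp only [mul_sub, sub_mul, mul_one, one_mul, h]; abel
  · simp only [jAdjoint_sub, jAdjoint_one hJ, jAdjoint_jAdjoint hJ, mul_sub, sub_mul, mul_one,
      one_mul, hQ.2]
    abel

theorem jOrthogonal_range (hJ : IsFundamentalSymmetry J) {Q : H →L[ℂ] H}
    (hQ : Q ∈ jNormalProjections J) : jOrthogonal J Q.range = (1 - jAdjoint J Q).range := by
  ext x
  rw [mem_jOrthogonal_range_iff hJ, mem_range_iff_of_mul_self (one_sub_jAdjoint_mem hJ hQ).1]
  change _ ↔ x - jAdjoint J Q x = x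
  rw [sub_eq_self]

theorem mul_one_sub_jAdjoint_mul_self {Q : H →L[ℂ] H} (hJ : IsFundamentalSymmetry J)
    (hQ : Q ∈ jNormalProjections J) :
    Q * (1 - jAdjoint J Q) * (Q * (1 - jAdjoint J Q)) = Q * (1 - jAdjoint J Q) := by
  have h : Commute Q (1 - jAdjoint J Q) := (Commute.one_right Q).sub_right hQ.2
  rw [h.symm.mul_mul_mul_comm, hQ.1, (one_sub_jAdjoint_mem hJ hQ).1]

theorem mul_jAdjoint_mul_mul_one_sub_jAdjoint (hJ : IsFundamentalSymmetry J) {Q : H →L[ℂ] H}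
    (hQ : Q ∈ jNormalProjections J) : Q * jAdjoint J Q * (Q * (1 - jAdjoint J Q)) = 0 := by
  have h : jAdjoint J Q * jAdjoint J Q = jAdjoint J Q := by rw [← jAdjoint_mul hJ, hQ.1]
  rw [hQ.2, mul_assoc, ← mul_assoc Q, hQ.1, mul_sub, mul_one, hQ.2, mul_sub, ← mul_assoc, h,
    sub_self]

theorem mul_one_sub_jAdjoint_mul_mul_jAdjoint (hJ : IsFundamentalSymmetry J) {Q : H →L[ℂ] H}
    (hQ : Q ∈ jNormalProjections J) : Q * (1 - jAdjoint J Q) * (Q * jAdjoint J Q) = 0 := by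
  have h : jAdjoint J Q * jAdjoint J Q = jAdjoint J Q := by rw [← jAdjoint_mul hJ, hQ.1]
  rw [hQ.2, mul_assoc, ← mul_assoc (1 - jAdjoint J Q), sub_mul, one_mul, h, sub_self,
    zero_mul, mul_zero]

theorem isotropicPart_range (hJ : IsFundamentalSymmetry J) {Q : H →L[ℂ] H}
    (hQ : Q ∈ jNormalProjections J) :
    isotropicPart J Q.range = (Q * (1 - jAdjoint J Q)).range := by
  have h : Q * (1 - jAdjoint J Q) = (1 - jAdjoint J Q) * Q := by
    rw [mul_sub, sub_mul, hQ.2, mul_one, one_mul]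
  ext x
  rw [isotropicPart, jOrthogonal_range hJ hQ, Submodule.mem_inf]
  constructor
  · rintro ⟨h1, h2⟩
    rw [mem_range_iff_of_mul_self hQ.1] at h1
    rw [mem_range_iff_of_mul_self (one_sub_jAdjoint_mem hJ hQ).1] at h2
    exact ⟨x, (congrArg Q h2).trans h1⟩
  · rintro ⟨y, rfl⟩
    refine ⟨⟨(1 - jAdjoint J Q) y, rfl⟩, ?_⟩
    rw [h]
    exact ⟨Q y, rfl⟩

/-- The signatures can be computed from any decomposition of `S` into its isotropic part, a
positive definite and a negative definite subspace: these need not be `J`-orthogonal, nor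
uniformly definite. -/
theorem signature_eq_dim (hJ : IsFundamentalSymmetry J) {S P N P₀ N₀ : Submodule ℂ H}
    (h : IsSignatureDecomposition J S P₀ N₀)
    (hP : ∀ f ∈ P, (form J f f).re ≤ 0 → f = 0) (hN : ∀ f ∈ N, 0 ≤ (form J f f).re → f = 0)
    (hsup : isotropicPart J S ⊔ (P ⊔ N) = S) :
    posSignature J S = dim P ∧ negSignature J S = dim N := by
  have form_zero : form J 0 0 = 0 := by simp [form]
  have hPS : P ≤ S := (le_sup_left.trans le_sup_right).trans hsup.le
  have hNS : N ≤ S := (le_sup_right.trans le_sup_right).trans hsup.le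
  have hP₀ : ∀ f ∈ P₀, (form J f f).re ≤ 0 → f = 0 := fun f => h.isUniformlyPositive.eq_zero
  have hN₀ : ∀ f ∈ N₀, 0 ≤ (form J f f).re → f = 0 := fun f => h.isUniformlyNegative.eq_zero
  -- a vector in both subspaces has the same form value as its component in `N`
  have disj {P N : Submodule ℂ H} (hN' : N ≤ S) (hP : ∀ f ∈ P, (form J f f).re ≤ 0 → f = 0)
      (hN : ∀ f ∈ N, 0 ≤ (form J f f).re → f = 0) : Disjoint P (isotropicPart J S ⊔ N) := by
    rw [Submodule.disjoint_def]
    intro x hx hx'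
    obtain ⟨s, hs, m, hm, rfl⟩ := Submodule.mem_sup.1 hx'
    refine hP _ hx ?_
    rw [form_add_isotropic hJ hs (hN' hm)]
    by_contra! hlt
    rw [hN m hm hlt.le, form_zero] at hlt
    exact lt_irrefl _ hlt
  have disj' {P N : Submodule ℂ H} (hP' : P ≤ S) (hP : ∀ f ∈ P, (form J f f).re ≤ 0 → f = 0)
      (hN : ∀ f ∈ N, 0 ≤ (form J f f).re → f = 0) : Disjoint N (isotropicPart J S ⊔ P) := by
    rw [Submodule.disjoint_def]
    intro x hx hx'
    obtain ⟨s, hs, m, hm, rfl⟩ := Submodule.mem_sup.1 hx'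
    refine hN _ hx ?_
    rw [form_add_isotropic hJ hs (hP' hm)]
    by_contra! hlt
    rw [hP m hm hlt.le, form_zero] at hlt
    exact lt_irrefl _ hlt
  have e1 : isotropicPart J S ⊔ N ⊔ P = S := by rw [sup_assoc, sup_comm N, hsup]
  have e2 : isotropicPart J S ⊔ N₀ ⊔ P₀ = S := by rw [sup_assoc, sup_comm N₀, h.sup_eq]
  rw [posSignature_eq hJ h, negSignature_eq hJ h, dim, dim, dim, dim,
    le_antisymm (rank_le_of_disjoint e1 h.pos_le (disj hNS hP₀ hN))
      (rank_le_of_disjoint e2 hPS (disj h.neg_le hP hN₀)),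
    le_antisymm (rank_le_of_disjoint ((sup_assoc _ _ _).trans hsup) h.neg_le (disj' hPS hP hN₀))
      (rank_le_of_disjoint ((sup_assoc _ _ _).trans h.sup_eq) hNS (disj' h.pos_le hP₀ hN))]
  exact ⟨rfl, rfl⟩

end Signature

/-! ### Signatures under `J`-isometric equivalences -/

section Transport

variable {H : Type*} [NormedAddCommGroup H] [InnerProductSpace ℂ H]
  {J : H →L[ℂ] H}

theorem dim_map (e : H ≃ₗ[ℂ] H) (S : Submodule ℂ H) :
    dim (S.map (e : H →ₗ[ℂ] H)) = dim S := by
  rw [dim, dim, (e.submoduleMap S).rank_eq]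

theorem jOrthogonal_map (e : H ≃L[ℂ] H) (he : ∀ x y, form J (e x) (e y) = form J x y)
    (S : Submodule ℂ H) :
    jOrthogonal J (S.map (e.toLinearEquiv : H →ₗ[ℂ] H)) =
      (jOrthogonal J S).map (e.toLinearEquiv : H →ₗ[ℂ] H) := by
  ext x
  constructor
  · intro hx
    refine ⟨e.symm x, fun g hg => ?_, e.apply_symm_apply x⟩
    rw [← he, e.apply_symm_apply]
    exact hx _ ⟨g, hg, rfl⟩
  · rintro ⟨y, hy, rfl⟩ _ ⟨g, hg, rfl⟩
    exact (he y g).trans (hy g hg)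

theorem isotropicPart_map (e : H ≃L[ℂ] H) (he : ∀ x y, form J (e x) (e y) = form J x y)
    (S : Submodule ℂ H) :
    isotropicPart J (S.map (e.toLinearEquiv : H →ₗ[ℂ] H)) =
      (isotropicPart J S).map (e.toLinearEquiv : H →ₗ[ℂ] H) := by
  rw [isotropicPart, jOrthogonal_map e he, isotropicPart, Submodule.map_inf _ e.injective]

theorem isClosed_map (e : H ≃L[ℂ] H) {S : Submodule ℂ H} (hS : IsClosed (S : Set H)) :
    IsClosed (S.map (e.toLinearEquiv : H →ₗ[ℂ] H) : Set H) :=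
  e.toHomeomorph.isClosedMap _ hS

theorem exists_mul_norm_sq_map_le (e : H ≃L[ℂ] H) {c : ℝ} (hc : 0 < c) :
    ∃ d : ℝ, 0 < d ∧ ∀ x, d * ‖e x‖ ^ 2 ≤ c * ‖x‖ ^ 2 := by
  set K := ‖(e : H →L[ℂ] H)‖ with hK
  have hK1 : 0 < K ^ 2 + 1 := by positivity
  refine ⟨c / (K ^ 2 + 1), by positivity, fun x => ?_⟩
  have h1 : ‖e x‖ ≤ K * ‖x‖ := (e : H →L[ℂ] H).le_opNorm x
  have h2 : ‖e x‖ ^ 2 ≤ (K ^ 2 + 1) * ‖x‖ ^ 2 := by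
    calc ‖e x‖ ^ 2 ≤ (K * ‖x‖) ^ 2 := by gcongr
      _ ≤ (K ^ 2 + 1) * ‖x‖ ^ 2 := by nlinarith [sq_nonneg ‖x‖]
  calc c / (K ^ 2 + 1) * ‖e x‖ ^ 2 ≤ c / (K ^ 2 + 1) * ((K ^ 2 + 1) * ‖x‖ ^ 2) := by gcongr
    _ = c * ‖x‖ ^ 2 := by field_simp

theorem IsSignatureDecomposition.map (e : H ≃L[ℂ] H)
    (he : ∀ x y, form J (e x) (e y) = form J x y) {S P N : Submodule ℂ H}
    (h : IsSignatureDecomposition J S P N) :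
    IsSignatureDecomposition J (S.map (e.toLinearEquiv : H →ₗ[ℂ] H))
      (P.map (e.toLinearEquiv : H →ₗ[ℂ] H)) (N.map (e.toLinearEquiv : H →ₗ[ℂ] H)) := by
  have hdisj {A B : Submodule ℂ H} (hAB : Disjoint A B) :
      Disjoint (A.map (e.toLinearEquiv : H →ₗ[ℂ] H)) (B.map (e.toLinearEquiv : H →ₗ[ℂ] H)) :=
    Submodule.disjoint_map e.injective hAB
  refine ⟨isClosed_map e h.isClosed, ?_, ?_, ?_, hdisj h.disjoint, ?_, ?_, ?_⟩
  · obtain ⟨c, hc, hP⟩ := h.isUniformlyPositive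
    obtain ⟨d, hd, hde⟩ := exists_mul_norm_sq_map_le e hc
    refine ⟨d, hd, ?_⟩
    rintro _ ⟨x, hx, rfl⟩
    exact (hde x).trans ((hP x hx).trans (congrArg Complex.re (he x x)).ge)
  · obtain ⟨c, hc, hN⟩ := h.isUniformlyNegative
    obtain ⟨d, hd, hde⟩ := exists_mul_norm_sq_map_le e hc
    refine ⟨d, hd, ?_⟩
    rintro _ ⟨x, hx, rfl⟩
    exact (congrArg Complex.re (he x x)).le.trans ((hN x hx).trans (neg_le_neg (hde x)))
  · rintro _ ⟨x, hx, rfl⟩ _ ⟨y, hy, rfl⟩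
    exact (he x y).trans (h.orthogonal x hx y hy)
  · rw [← Submodule.map_sup]
    refine ⟨isClosed_map e h.isRegular.1, ?_⟩
    rw [jOrthogonal_map e he]
    exact (Submodule.orderIsoMapComap e.toLinearEquiv).isCompl h.isRegular.2
  · rw [isotropicPart_map e he, ← Submodule.map_sup]
    exact hdisj h.disjoint_isotropicPart
  · rw [isotropicPart_map e he, ← Submodule.map_sup, ← Submodule.map_sup, h.sup_eq]

end Transport

/-! ### Partial isometries between orthogonal projections -/

section PartialIsometry

variable {H : Type*} [NormedAddCommGroup H] [InnerProductSpace ℂ H]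

theorem Orthonormal.countable [TopologicalSpace.SeparableSpace H] {ι : Type*} {v : ι → H}
    (hv : Orthonormal ℂ v) : Countable ι := by
  refine Pairwise.countable_of_isOpen_disjoint (s := fun i => Metric.ball (v i) 2⁻¹) ?_
    (fun i => Metric.isOpen_ball) fun i => ⟨v i, Metric.mem_ball_self (by norm_num)⟩
  intro i j hij
  refine Metric.ball_disjoint_ball ?_
  have h1 : ‖v i - v j‖ ^ 2 = 2 := by
    rw [norm_sub_sq (𝕜 := ℂ), hv.1, hv.1, hv.2 hij]
    norm_num
  rw [dist_eq_norm]
  nlinarith [norm_nonneg (v i - v j)]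

theorem HilbertBasis.card_eq_dim {S : Submodule ℂ H} {ι : Type*} (b : HilbertBasis ι ℂ S) :
    ENat.card ι = dim S := by
  classical
  rw [dim, ENat.card]
  rcases finite_or_infinite ι with h | h
  · have := Fintype.ofFinite ι
    have := LinearEquiv.lift_rank_eq b.toOrthonormalBasis.toBasis.equivFun
    have h2 := congrArg Cardinal.toENat this
    simpa using h2.symm
  · have h1 := b.orthonormal.linearIndependent.cardinal_lift_le_rank
    have h2 : Cardinal.aleph0 ≤ Module.rank ℂ S := by
      refine Cardinal.aleph0_le_lift.1 (le_trans ?_ h1)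
      exact Cardinal.aleph0_le_lift.2 (Cardinal.aleph0_le_mk ι)
    rw [Cardinal.toENat_eq_top.2 h2, Cardinal.toENat_eq_top.2 (Cardinal.aleph0_le_mk ι)]

theorem nonempty_equiv_of_card_eq {α β : Type*} [Countable α] [Countable β]
    (h : ENat.card α = ENat.card β) : Nonempty (α ≃ β) := by
  rcases finite_or_infinite α with hα | hα
  · rcases finite_or_infinite β with hβ | hβ
    · rw [ENat.card_eq_coe_natCard, ENat.card_eq_coe_natCard, Nat.cast_inj] at h
      exact (Finite.card_eq.1 h)
    · rw [ENat.card_eq_top.2 hβ, ENat.card_eq_top] at h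
      exact (not_finite α).elim
  · rw [ENat.card_eq_top.2 hα, eq_comm, ENat.card_eq_top] at h
    exact nonempty_equiv_of_countable

variable [CompleteSpace H]

/-- In a separable Hilbert space, complete subspaces of the same dimension in `ℕ ∪ {∞}` are
isometrically isomorphic. -/
theorem nonempty_linearIsometryEquiv_of_dim_eq [TopologicalSpace.SeparableSpace H]
    {K L : Submodule ℂ H} [CompleteSpace K] [CompleteSpace L] (h : dim K = dim L) :
    Nonempty (K ≃ₗᵢ[ℂ] L) := by
  obtain ⟨v, b, -⟩ := exists_hilbertBasis ℂ K
  obtain ⟨w, c, -⟩ := exists_hilbertBasis ℂ L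
  have := Orthonormal.countable b.orthonormal
  have := Orthonormal.countable c.orthonormal
  rw [← HilbertBasis.card_eq_dim b, ← HilbertBasis.card_eq_dim c] at h
  obtain ⟨e⟩ := nonempty_equiv_of_card_eq h
  have hc : Orthonormal ℂ (c ∘ e) := c.orthonormal.comp e e.injective
  have hsp : ⊤ ≤ (Submodule.span ℂ (Set.range (c ∘ e))).topologicalClosure := by
    rw [e.surjective.range_comp, c.dense_span]
  exact ⟨b.repr.trans (HilbertBasis.mk hc hsp).repr.symm⟩

/-- The operator `v` is a partial isometry with initial projection `p` and final projection `q`. -/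
structure IsPartialIsometryBetween (v p q : H →L[ℂ] H) : Prop where
  star_mul_self : star v * v = p
  mul_star_self : v * star v = q
  mul_right : v * p = v
  mul_left : q * v = v

theorem mul_eq_self_of_star_mul_self {v p : H →L[ℂ] H} (hp : IsStarProjection p)
    (h : star v * v = p) : v * p = v := by
  have hpp := hp.isIdempotentElem.eq
  rw [← sub_eq_zero, ← CStarRing.star_mul_self_eq_zero_iff, star_sub, star_mul,
    hp.isSelfAdjoint.star_eq]
  simp only [mul_sub, sub_mul, mul_assoc, h, hpp]
  rw [← mul_assoc (star v), h, hpp, hpp, sub_self]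

/-- Two orthogonal projections with ranges of the same dimension are the initial and final
projections of a partial isometry. -/
theorem exists_isPartialIsometryBetween [TopologicalSpace.SeparableSpace H] {p q : H →L[ℂ] H}
    (hp : IsStarProjection p) (hq : IsStarProjection q) (h : dim p.range = dim q.range) :
    ∃ v, IsPartialIsometryBetween v p q := by
  have : CompleteSpace p.range :=
    (isClosed_range_of_mul_self hp.isIdempotentElem.eq).completeSpace_coe
  have : CompleteSpace q.range :=
    (isClosed_range_of_mul_self hq.isIdempotentElem.eq).completeSpace_coe
  obtain ⟨e⟩ := nonempty_linearIsometryEquiv_of_dim_eq h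
  let p' : H →L[ℂ] p.range := p.codRestrict p.range fun x => ⟨x, rfl⟩
  let q' : H →L[ℂ] q.range := q.codRestrict q.range fun x => ⟨x, rfl⟩
  let v : H →L[ℂ] H := q.range.subtypeL ∘L (e.toContinuousLinearEquiv : _ →L[ℂ] _) ∘L p'
  let w : H →L[ℂ] H := p.range.subtypeL ∘L (e.symm.toContinuousLinearEquiv : _ →L[ℂ] _) ∘L q'
  have proj {r : H →L[ℂ] H} (hr : IsStarProjection r) {x : H} (hx : x ∈ r.range) (y : H) :
      (inner ℂ x (r y) : ℂ) = inner ℂ x y := by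
    rw [← ContinuousLinearMap.adjoint_inner_left, ← ContinuousLinearMap.star_eq_adjoint,
      hr.isSelfAdjoint.star_eq, (mem_range_iff_of_mul_self hr.isIdempotentElem.eq).1 hx]
  have proj' {r : H →L[ℂ] H} (hr : IsStarProjection r) {x : H} (hx : x ∈ r.range) (y : H) :
      (inner ℂ (r y) x : ℂ) = inner ℂ y x := by
    rw [← inner_conj_symm, proj hr hx, inner_conj_symm]
  have hvw : star v = w := by
    rw [ContinuousLinearMap.star_eq_adjoint, eq_comm, ContinuousLinearMap.eq_adjoint_iff]
    intro x y
    calc inner ℂ (w x) y = inner ℂ (w x) (p y) := (proj hp (e.symm (q' x)).2 y).symm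
      _ = inner ℂ (e.symm (q' x)) (p' y) := rfl
      _ = inner ℂ (q' x) (e (p' y)) := by
          rw [← e.inner_map_map, e.apply_symm_apply]
      _ = inner ℂ (q x) (v y) := rfl
      _ = inner ℂ x (v y) := proj' hq (e (p' y)).2 x
  have hwv : w * v = p := by
    ext x
    have h1 : q' (v x) = e (p' x) := Subtype.ext
      ((mem_range_iff_of_mul_self hq.isIdempotentElem.eq).1 (e (p' x)).2)
    change ((e.symm (q' (v x)) : p.range) : H) = p x
    rw [h1, e.symm_apply_apply]
    rfl
  have hvw' : v * w = q := by
    ext x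
    have h1 : p' (w x) = e.symm (q' x) := Subtype.ext
      ((mem_range_iff_of_mul_self hp.isIdempotentElem.eq).1 (e.symm (q' x)).2)
    change ((e (p' (w x)) : q.range) : H) = q x
    rw [h1, e.apply_symm_apply]
    rfl
  refine ⟨v, by rw [hvw, hwv], by rw [hvw, hvw'],
    mul_eq_self_of_star_mul_self hp (by rw [hvw, hwv]), ?_⟩
  have := congrArg star
    (mul_eq_self_of_star_mul_self (v := star v) hq (by rw [star_star, hvw, hvw']))
  simpa [hq.isSelfAdjoint.star_eq] using this

theorem IsPartialIsometryBetween.add {v w p q p' q' : H →L[ℂ] H}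
    (hv : IsPartialIsometryBetween v p q) (hw : IsPartialIsometryBetween w p' q')
    (hp : p * p' = 0) (hq : q * q' = 0) : IsPartialIsometryBetween (v + w) (p + p') (q + q') := by
  have hps : star p = p := by rw [← hv.star_mul_self, star_mul, star_star]
  have hqs : star q = q := by rw [← hv.mul_star_self, star_mul, star_star]
  have hps' : star p' = p' := by rw [← hw.star_mul_self, star_mul, star_star]
  have hqs' : star q' = q' := by rw [← hw.mul_star_self, star_mul, star_star]
  have hp' : p' * p = 0 := by simpa [hps, hps'] using congrArg star hp
  have hq' : q' * q = 0 := by simpa [hqs, hqs'] using congrArg star hq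
  have h1 : star v * q = star v := by simpa [hqs] using congrArg star hv.mul_left
  have h2 : p' * star w = star w := by simpa [hps'] using congrArg star hw.mul_right
  have h3 : star v * w = 0 := by
    rw [← h1, ← hw.mul_left, mul_assoc, ← mul_assoc q, hq, zero_mul, mul_zero]
  have h4 : v * star w = 0 := by
    rw [← h2, ← hv.mul_right, mul_assoc, ← mul_assoc p, hp, zero_mul, mul_zero]
  have h3' : star w * v = 0 := by simpa using congrArg star h3
  have h4' : w * star v = 0 := by simpa using congrArg star h4
  have h5 : v * p' = 0 := by rw [← hv.mul_right, mul_assoc, hp, mul_zero]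
  have h6 : w * p = 0 := by rw [← hw.mul_right, mul_assoc, hp', mul_zero]
  have h7 : q * w = 0 := by rw [← hw.mul_left, ← mul_assoc, hq, zero_mul]
  have h8 : q' * v = 0 := by rw [← hv.mul_left, ← mul_assoc, hq', zero_mul]
  constructor
  · simp [mul_add, add_mul, hv.star_mul_self, hw.star_mul_self, h3, h3']
  · simp [mul_add, add_mul, hv.mul_star_self, hw.mul_star_self, h4, h4']
  · simp [mul_add, add_mul, hv.mul_right, hw.mul_right, h5, h6]
  · simp [mul_add, add_mul, hv.mul_left, hw.mul_left, h7, h8]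

/-- Conjugation by a fundamental symmetry preserves partial isometries. -/
theorem IsPartialIsometryBetween.conj {J v p q : H →L[ℂ] H} (hJ : IsFundamentalSymmetry J)
    (hv : IsPartialIsometryBetween v p q) :
    IsPartialIsometryBetween (J * v * J) (J * p * J) (J * q * J) := by
  have hs : star (J * v * J) = J * star v * J := by
    simp only [star_mul, hJ.star_eq, mul_assoc]
  constructor
  · rw [hs, ← hv.star_mul_self]; simp only [mul_assoc, mul_mul_cancel hJ]
  · rw [hs, ← hv.mul_star_self]; simp only [mul_assoc, mul_mul_cancel hJ]
  · conv_rhs => rw [← hv.mul_right]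
    simp only [mul_assoc, mul_mul_cancel hJ]
  · conv_rhs => rw [← hv.mul_left]
    simp only [mul_assoc, mul_mul_cancel hJ]

end PartialIsometry

/-! ### Orthogonal `J`-normal projections -/

section OrthogonalProjection

variable {H : Type*} [NormedAddCommGroup H] [InnerProductSpace ℂ H]

theorem range_sup_range {R S T : H →L[ℂ] H} (h : S + T = R) (hS : R * S = S) (hT : R * T = T) :
    S.range ⊔ T.range = R.range := by
  refine le_antisymm (sup_le ?_ ?_) ?_
  · rintro _ ⟨x, rfl⟩
    exact ⟨S x, congrArg (fun A : H →L[ℂ] H => A x) hS⟩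
  · rintro _ ⟨x, rfl⟩
    exact ⟨T x, congrArg (fun A : H →L[ℂ] H => A x) hT⟩
  · rintro _ ⟨x, rfl⟩
    rw [← h]
    exact Submodule.add_mem_sup ⟨x, rfl⟩ ⟨x, rfl⟩

theorem disjoint_range {S T : H →L[ℂ] H} (hS : S * S = S) (h : S * T = 0) :
    Disjoint S.range T.range := by
  rw [Submodule.disjoint_def]
  rintro _ h1 ⟨x, rfl⟩
  rw [mem_range_iff_of_mul_self hS] at h1
  rw [← h1]
  exact congrArg (fun A : H →L[ℂ] H => A x) h

variable [CompleteSpace H] {J : H →L[ℂ] H}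

/-- An orthogonal projection `E` commuting with `J` splits into its parts in the eigenspaces of
`J` for the eigenvalues `1` and `-1`. -/
theorem exists_eigen_splitting (hJ : IsFundamentalSymmetry J) {E : H →L[ℂ] H}
    (hE : IsStarProjection E) (hEJ : J * E = E * J) :
    ∃ A B : H →L[ℂ] H, IsStarProjection A ∧ IsStarProjection B ∧ J * A = A ∧ J * B = -B ∧
      A * B = 0 ∧ A + B = E := by
  have hEE := hE.isIdempotentElem.eq
  have hEs := hE.isSelfAdjoint.star_eq
  have hEJE : E * (J * E) = J * E := by rw [hEJ, ← mul_assoc, hEE]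
  have h4 : (4 : ℂ)⁻¹ = 2⁻¹ * 2⁻¹ := by norm_num
  have hhalf (T : H →L[ℂ] H) : (2⁻¹ : ℂ) • (T + T) = T := by
    rw [← two_smul ℂ, smul_smul]; norm_num
  have h1 : E * E = E := hEE
  have h2 : J * E * E = J * E := by rw [mul_assoc, hEE]
  have h3 : J * E * (J * E) = E := by rw [mul_assoc, hEJE, mul_mul_cancel hJ]
  have hsJE : star (J * E) = J * E := by rw [star_mul, hEs, hJ.star_eq, hEJ]
  refine ⟨(2⁻¹ : ℂ) • (E + J * E), (2⁻¹ : ℂ) • (E - J * E), ⟨?_, ?_⟩, ⟨?_, ?_⟩, ?_, ?_, ?_, ?_⟩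
  · change (2⁻¹ : ℂ) • (E + J * E) * (2⁻¹ : ℂ) • (E + J * E) = (2⁻¹ : ℂ) • (E + J * E)
    rw [smul_mul_assoc, mul_smul_comm]
    congr 1
    rw [add_mul, mul_add, mul_add, h1, hEJE, h2, h3, add_comm (J * E) E, hhalf]
  · rw [isSelfAdjoint_iff, star_smul, star_add, hsJE, hEs]; simp
  · change (2⁻¹ : ℂ) • (E - J * E) * (2⁻¹ : ℂ) • (E - J * E) = (2⁻¹ : ℂ) • (E - J * E)
    rw [smul_mul_assoc, mul_smul_comm]
    congr 1
    rw [sub_mul, mul_sub, mul_sub, h1, hEJE, h2, h3, ← neg_sub E (J * E), sub_neg_eq_add, hhalf]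
  · rw [isSelfAdjoint_iff, star_smul, star_sub, hsJE, hEs]; simp
  · rw [mul_smul_comm, mul_add, mul_mul_cancel hJ, add_comm]
  · rw [mul_smul_comm, mul_sub, mul_mul_cancel hJ, ← smul_neg, neg_sub]
  · rw [smul_mul_assoc, mul_smul_comm, add_mul, mul_sub, mul_sub, h1, hEJE, h2, h3,
      sub_add_sub_cancel, sub_self, smul_zero, smul_zero]
  · rw [← smul_add, add_add_sub_cancel, hhalf]

/-- For a `J`-normal orthogonal projection `Q`, the projections onto the isotropic part of the
range and onto the eigenspaces of `J` in its complement give a signature decomposition. -/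
theorem exists_isSignatureDecomposition_of_star_eq (hJ : IsFundamentalSymmetry J) {Q : H →L[ℂ] H}
    (hQ : Q ∈ jNormalProjections J) (hs : star Q = Q) :
    ∃ A B : H →L[ℂ] H, IsStarProjection A ∧ IsStarProjection B ∧ J * A = A ∧ J * B = -B ∧
      A * B = 0 ∧ A + B = Q * jAdjoint J Q ∧
      IsSignatureDecomposition J Q.range A.range B.range := by
  have hQ' : jAdjoint J Q = J * Q * J := by rw [jAdjoint_eq, hs]
  have hQ1' : jAdjoint J Q * jAdjoint J Q = jAdjoint J Q := by rw [← jAdjoint_mul hJ, hQ.1]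
  have hs' : star (jAdjoint J Q) = jAdjoint J Q := by
    rw [hQ']; simp only [star_mul, hJ.star_eq, hs, mul_assoc]
  set E := Q * jAdjoint J Q with hE
  have hEE : E * E = E := by
    rw [hE, (Commute.mul_mul_mul_comm (hQ.2.symm : Commute (jAdjoint J Q) Q)), hQ.1, hQ1']
  have hEs : star E = E := by rw [hE, star_mul, hs', hs, hQ.2]
  have hEJ : J * E = E * J := by
    have h1 : J * E = Q * J * Q := by
      rw [hE, hQ.2, hQ']; simp only [mul_assoc, mul_mul_cancel hJ]
    have h2 : E * J = Q * J * Q := by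
      rw [hE, hQ']; simp only [mul_assoc, hJ.mul_self, mul_one]
    rw [h1, h2]
  have hEa : jAdjoint J E = E := by rw [jAdjoint_eq, hEs, hEJ, mul_assoc, hJ.mul_self, mul_one]
  have hEN : E ∈ jNormalProjections J := ⟨hEE, by rw [hEa]⟩
  obtain ⟨A, B, hA, hB, hJA, hJB, hAB, hABE⟩ := exists_eigen_splitting hJ ⟨hEE, hEs⟩ hEJ
  have hAA := hA.isIdempotentElem.eq
  have hBB := hB.isIdempotentElem.eq
  have hBA : B * A = 0 := by
    simpa [hA.isSelfAdjoint.star_eq, hB.isSelfAdjoint.star_eq] using congrArg star hAB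
  have hEA : E * A = A := by rw [← hABE, add_mul, hAA, hBA, add_zero]
  have hEB : E * B = B := by rw [← hABE, add_mul, hAB, hBB, zero_add]
  have hrE : A.range ⊔ B.range = E.range := range_sup_range hABE hEA hEB
  have hAmem {x : H} (hx : x ∈ A.range) : J x = x := by
    obtain ⟨y, rfl⟩ := hx
    exact congrArg (fun T : H →L[ℂ] H => T y) hJA
  have hBmem {x : H} (hx : x ∈ B.range) : J x = -x := by
    obtain ⟨y, rfl⟩ := hx
    exact congrArg (fun T : H →L[ℂ] H => T y) hJB
  have hFE : Q * (1 - jAdjoint J Q) * E = 0 := mul_one_sub_jAdjoint_mul_mul_jAdjoint hJ hQ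
  refine ⟨A, B, hA, hB, hJA, hJB, hAB, hABE, isClosed_range_of_mul_self hQ.1, ?_, ?_, ?_,
    disjoint_range hAA hAB, ?_, ?_, ?_⟩
  · refine ⟨1, one_pos, fun f hf => ?_⟩
    rw [form, hAmem hf, one_mul]
    exact (inner_self_eq_norm_sq (𝕜 := ℂ) f).ge
  · refine ⟨1, one_pos, fun f hf => ?_⟩
    rw [form, hBmem hf, inner_neg_left, Complex.neg_re, one_mul]
    exact neg_le_neg (inner_self_eq_norm_sq (𝕜 := ℂ) f).ge
  · intro f hf g hg
    have h1 := form_conj_symm hJ f g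
    have h2 : form J f g = inner ℂ f g := by rw [form, hAmem hf]
    have h3 : form J g f = -inner ℂ g f := by rw [form, hBmem hg, inner_neg_left]
    rw [h3, map_neg, inner_conj_symm, h2] at h1
    rw [h2]
    exact self_eq_neg.1 h1
  · rw [hrE]
    refine ⟨isClosed_range_of_mul_self hEE, ?_⟩
    rw [jOrthogonal_range hJ hEN, hEa]
    refine ⟨disjoint_range hEE (by rw [mul_sub, hEE, mul_one, sub_self]), ?_⟩
    rw [codisjoint_iff, range_sup_range (R := 1) (by abel) (one_mul _) (one_mul _)]
    exact LinearMap.range_id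
  · rw [isotropicPart_range hJ hQ, hrE]
    exact disjoint_range (mul_one_sub_jAdjoint_mul_self hJ hQ) hFE
  · rw [isotropicPart_range hJ hQ, hrE]
    refine range_sup_range ?_ ?_ ?_
    · rw [hE, mul_sub, mul_one, sub_add_cancel]
    · rw [← mul_assoc, hQ.1]
    · rw [hE, ← mul_assoc, hQ.1]

end OrthogonalProjection

/-! ### Classification of orbits -/

section Classification

variable {H : Type*} [NormedAddCommGroup H] [InnerProductSpace ℂ H]
  {J : H →L[ℂ] H}

/-- The positive, negative and isotropic signatures of `S` and `S'` agree. -/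
def SameSignature (J : H →L[ℂ] H) (S S' : Submodule ℂ H) : Prop :=
  posSignature J S = posSignature J S' ∧ negSignature J S = negSignature J S' ∧
    isotropicSignature J S = isotropicSignature J S'

theorem SameSignature.symm {S S' : Submodule ℂ H} (h : SameSignature J S S') :
    SameSignature J S' S :=
  ⟨h.1.symm, h.2.1.symm, h.2.2.symm⟩

theorem SameSignature.trans {S S' S'' : Submodule ℂ H} (h : SameSignature J S S')
    (h' : SameSignature J S' S'') : SameSignature J S S'' :=
  ⟨h.1.trans h'.1, h.2.1.trans h'.2.1, h.2.2.trans h'.2.2⟩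

theorem range_eq_map_of_mul_eq (e : H ≃L[ℂ] H) {S T : H →L[ℂ] H}
    (h : (e : H →L[ℂ] H) * S = T * (e : H →L[ℂ] H)) :
    T.range = S.range.map (e.toLinearEquiv : H →ₗ[ℂ] H) := by
  have h' (x : H) : e (S x) = T (e x) := congrArg (fun A : H →L[ℂ] H => A x) h
  ext x
  constructor
  · rintro ⟨y, rfl⟩
    refine ⟨S (e.symm y), ⟨_, rfl⟩, (h' _).trans ?_⟩
    rw [e.apply_symm_apply]
    rfl
  · rintro ⟨_, ⟨y, rfl⟩, rfl⟩
    exact ⟨e y, (h' y).symm⟩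

variable [CompleteSpace H]

/-- The range of a `J`-normal projection and its `J`-orthogonal subspace have the same isotropic
part. -/
theorem isotropicPart_range_one_sub_jAdjoint (hJ : IsFundamentalSymmetry J) {Q : H →L[ℂ] H}
    (hQ : Q ∈ jNormalProjections J) :
    isotropicPart J (1 - jAdjoint J Q).range = isotropicPart J Q.range := by
  rw [isotropicPart_range hJ (one_sub_jAdjoint_mem hJ hQ), isotropicPart_range hJ hQ, jAdjoint_sub,
    jAdjoint_one hJ, jAdjoint_jAdjoint hJ, sub_sub_cancel, mul_sub, sub_mul, hQ.2, mul_one, one_mul]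

/-- A `J`-unitary operator as a continuous linear equivalence. -/
noncomputable def equivOfMemJUnitary {U : H →L[ℂ] H} (hU : U ∈ jUnitary J) : H ≃L[ℂ] H :=
  ContinuousLinearEquiv.equivOfInverse U (jAdjoint J U)
    (fun x => congrArg (fun A : H →L[ℂ] H => A x) hU.2)
    (fun x => congrArg (fun A : H →L[ℂ] H => A x) hU.1)

theorem form_equivOfMemJUnitary (hJ : IsFundamentalSymmetry J) {U : H →L[ℂ] H}
    (hU : U ∈ jUnitary J) (x y : H) :
    form J (equivOfMemJUnitary hU x) (equivOfMemJUnitary hU y) = form J x y := by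
  have h1 : star U * J * U = J := by
    calc star U * J * U = J * (jAdjoint J U * U) := by
          rw [jAdjoint_eq]; simp only [mul_assoc, mul_mul_cancel hJ]
      _ = J := by rw [hU.2, mul_one]
  change inner ℂ (J (U x)) (U y) = inner ℂ (J x) y
  rw [← ContinuousLinearMap.adjoint_inner_left]
  exact congrArg (fun A : H →L[ℂ] H => inner ℂ (A x) y) h1

theorem mem_orbit_self (hJ : IsFundamentalSymmetry J) (Q : H →L[ℂ] H) : Q ∈ orbit J Q :=
  ⟨1, one_mem_jUnitary hJ, by rw [jAdjoint_one hJ, one_mul, mul_one]⟩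

theorem mem_orbit_symm (hJ : IsFundamentalSymmetry J) {Q Q₀ : H →L[ℂ] H} (h : Q ∈ orbit J Q₀) :
    Q₀ ∈ orbit J Q := by
  obtain ⟨U, hU, rfl⟩ := h
  refine ⟨jAdjoint J U, jAdjoint_mem_jUnitary hJ hU, ?_⟩
  rw [jAdjoint_jAdjoint hJ]
  calc Q₀ = jAdjoint J U * U * Q₀ * (jAdjoint J U * U) := by rw [hU.2, one_mul, mul_one]
    _ = _ := by simp only [mul_assoc]

theorem mem_orbit_trans (hJ : IsFundamentalSymmetry J) {Q Q₁ Q₂ : H →L[ℂ] H}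
    (h : Q ∈ orbit J Q₁) (h' : Q₁ ∈ orbit J Q₂) : Q ∈ orbit J Q₂ := by
  obtain ⟨U, hU, rfl⟩ := h
  obtain ⟨V, hV, rfl⟩ := h'
  refine ⟨U * V, mul_mem_jUnitary hJ hU hV, ?_⟩
  rw [jAdjoint_mul hJ]
  simp only [mul_assoc]

theorem orbit_subset (hJ : IsFundamentalSymmetry J) {Q : H →L[ℂ] H}
    (hQ : Q ∈ jNormalProjections J) : orbit J Q ⊆ jNormalProjections J := by
  rintro _ ⟨U, hU, rfl⟩
  have h (S T : H →L[ℂ] H) :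
      U * S * jAdjoint J U * (U * T * jAdjoint J U) = U * (S * T) * jAdjoint J U := by
    calc _ = U * S * (jAdjoint J U * U) * T * jAdjoint J U := by simp only [mul_assoc]
      _ = _ := by rw [hU.2, mul_one]; simp only [mul_assoc]
  have h' : jAdjoint J (U * Q * jAdjoint J U) = U * jAdjoint J Q * jAdjoint J U := by
    rw [jAdjoint_mul hJ, jAdjoint_mul hJ, jAdjoint_jAdjoint hJ, mul_assoc]
  exact ⟨by rw [h, hQ.1], by rw [h', h, h, hQ.2]⟩

/-- The map `Q ↦ 1 - Q^#`, which turns cosignatures into signatures, is equivariant. -/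
theorem one_sub_jAdjoint_mem_orbit (hJ : IsFundamentalSymmetry J) {Q Q₀ : H →L[ℂ] H}
    (h : Q ∈ orbit J Q₀) : 1 - jAdjoint J Q ∈ orbit J (1 - jAdjoint J Q₀) := by
  obtain ⟨U, hU, rfl⟩ := h
  refine ⟨U, hU, ?_⟩
  rw [jAdjoint_mul hJ, jAdjoint_mul hJ, jAdjoint_jAdjoint hJ, mul_sub, mul_one, sub_mul, hU.1,
    mul_assoc U]

theorem exists_isSignatureDecomposition (hJ : IsFundamentalSymmetry J) {Q : H →L[ℂ] H}
    (hQ : Q ∈ jNormalProjections J) :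
    ∃ P N : Submodule ℂ H, IsSignatureDecomposition J Q.range P N := by
  obtain ⟨U, hU, hs⟩ := exists_jUnitary_conj_isSelfAdjoint hJ hQ
  have hQ' : U * Q * jAdjoint J U ∈ orbit J Q := ⟨U, hU, rfl⟩
  obtain ⟨A, B, -, -, -, -, -, -, h⟩ :=
    exists_isSignatureDecomposition_of_star_eq hJ (orbit_subset hJ hQ hQ') hs
  have hV := jAdjoint_mem_jUnitary hJ hU
  have hmul : jAdjoint J U * (U * Q * jAdjoint J U) = Q * jAdjoint J U := by
    calc _ = jAdjoint J U * U * Q * jAdjoint J U := by simp only [mul_assoc]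
      _ = _ := by rw [hU.2, one_mul]
  rw [range_eq_map_of_mul_eq (equivOfMemJUnitary hV) hmul]
  exact ⟨_, _, h.map _ (form_equivOfMemJUnitary hJ hV)⟩

theorem sameSignature_of_mem_orbit (hJ : IsFundamentalSymmetry J) {Q Q₀ : H →L[ℂ] H}
    (hQ₀ : Q₀ ∈ jNormalProjections J) (h : Q ∈ orbit J Q₀) :
    SameSignature J Q.range Q₀.range := by
  obtain ⟨U, hU, rfl⟩ := h
  obtain ⟨P, N, hd⟩ := exists_isSignatureDecomposition hJ hQ₀
  have hmul : U * Q₀ = U * Q₀ * jAdjoint J U * U := by rw [mul_assoc _ _ U, hU.2, mul_one]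
  have he := form_equivOfMemJUnitary hJ hU
  rw [range_eq_map_of_mul_eq (equivOfMemJUnitary hU) hmul]
  have hd' := hd.map _ he
  refine ⟨?_, ?_, ?_⟩
  · rw [posSignature_eq hJ hd', posSignature_eq hJ hd, dim_map]
  · rw [negSignature_eq hJ hd', negSignature_eq hJ hd, dim_map]
  · rw [isotropicSignature, isotropicPart_map _ he, dim_map, isotropicSignature]

/-- Orthogonal projections with the same signatures and cosignatures are in the same orbit: partial
isometries between their corresponding spectral parts, chosen to commute with `J`, add up to a
unitary operator commuting with `J`. -/
theorem mem_orbit_of_star_eq [TopologicalSpace.SeparableSpace H] (hJ : IsFundamentalSymmetry J)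
    {Q Q₀ : H →L[ℂ] H} (hQ : Q ∈ jNormalProjections J) (hQ₀ : Q₀ ∈ jNormalProjections J)
    (hs : star Q = Q) (hs₀ : star Q₀ = Q₀) (h : SameSignature J Q.range Q₀.range)
    (hco : SameSignature J (1 - jAdjoint J Q).range (1 - jAdjoint J Q₀).range) :
    Q ∈ orbit J Q₀ := by
  have hs' {T : H →L[ℂ] H} (hT : star T = T) : star (jAdjoint J T) = jAdjoint J T := by
    rw [jAdjoint_eq]; simp only [star_mul, hJ.star_eq, hT, mul_assoc]
  have hs1 {T : H →L[ℂ] H} (hT : star T = T) : star (1 - jAdjoint J T) = 1 - jAdjoint J T := by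
    rw [star_sub, hs' hT, star_one]
  -- partial isometries between the nondegenerate parts
  have main {Q Q₀ : H →L[ℂ] H} (hQ : Q ∈ jNormalProjections J)
      (hQ₀ : Q₀ ∈ jNormalProjections J) (hs : star Q = Q) (hs₀ : star Q₀ = Q₀)
      (h : SameSignature J Q.range Q₀.range) :
      ∃ v, IsPartialIsometryBetween v (Q₀ * jAdjoint J Q₀) (Q * jAdjoint J Q) ∧
        J * v * J = v := by
    obtain ⟨A, B, hA, hB, hJA, hJB, hAB, hE, hd⟩ :=
      exists_isSignatureDecomposition_of_star_eq hJ hQ hs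
    obtain ⟨A₀, B₀, hA₀, hB₀, hJA₀, hJB₀, hAB₀, hE₀, hd₀⟩ :=
      exists_isSignatureDecomposition_of_star_eq hJ hQ₀ hs₀
    have hp := h.1
    have hn := h.2.1
    rw [posSignature_eq hJ hd, posSignature_eq hJ hd₀] at hp
    rw [negSignature_eq hJ hd, negSignature_eq hJ hd₀] at hn
    obtain ⟨a, ha⟩ := exists_isPartialIsometryBetween hA₀ hA hp.symm
    obtain ⟨b, hb⟩ := exists_isPartialIsometryBetween hB₀ hB hn.symm
    have hAJ : A₀ * J = A₀ := by
      simpa [hJ.star_eq, hA₀.isSelfAdjoint.star_eq] using congrArg star hJA₀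
    have hBJ : B₀ * J = -B₀ := by
      simpa [hJ.star_eq, hB₀.isSelfAdjoint.star_eq] using congrArg star hJB₀
    have haJ : J * a * J = a := by
      rw [← ha.mul_left, ← mul_assoc, hJA, mul_assoc, ← ha.mul_right, mul_assoc a, hAJ]
    have hbJ : J * b * J = b := by
      rw [← hb.mul_left, ← mul_assoc, hJB, mul_assoc, ← hb.mul_right, mul_assoc b, hBJ, mul_neg,
        neg_mul_neg]
    refine ⟨a + b, hE₀ ▸ hE ▸ ha.add hb hAB₀ hAB, ?_⟩
    rw [mul_add, add_mul, haJ, hbJ]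
  have hQ1 := one_sub_jAdjoint_mem hJ hQ
  have hQ1₀ := one_sub_jAdjoint_mem hJ hQ₀
  obtain ⟨v, hv, hvJ⟩ := main hQ hQ₀ hs hs₀ h
  obtain ⟨w, hw, hwJ⟩ := main hQ1 hQ1₀ (hs1 hs) (hs1 hs₀) hco
  -- the isotropic parts
  have hF {T : H →L[ℂ] H} (hT : T ∈ jNormalProjections J) (hTs : star T = T) :
      IsStarProjection (T * (1 - jAdjoint J T)) := by
    refine ⟨mul_one_sub_jAdjoint_mul_self hJ hT, ?_⟩
    rw [isSelfAdjoint_iff, star_mul, hs1 hTs, hTs, mul_sub, sub_mul, mul_one, one_mul, hT.2]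
  have hiso := h.2.2
  rw [isotropicSignature, isotropicSignature, isotropicPart_range hJ hQ,
    isotropicPart_range hJ hQ₀] at hiso
  obtain ⟨f, hf⟩ := exists_isPartialIsometryBetween (hF hQ₀ hs₀) (hF hQ hs) hiso.symm
  have hFJ {T : H →L[ℂ] H} (hTs : star T = T) :
      J * (T * (1 - jAdjoint J T)) * J = jAdjoint J T * (1 - T) := by
    rw [jAdjoint_eq, hTs]
    simp only [mul_sub, sub_mul, mul_one, mul_assoc, hJ.mul_self]
  have hf' := hf.conj hJ
  rw [hFJ hs, hFJ hs₀] at hf'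
  -- orthogonality and completeness relations between the four parts of a projection
  have r2 {T : H →L[ℂ] H} : T * jAdjoint J T + T * (1 - jAdjoint J T) = T := by
    rw [mul_sub, mul_one, add_sub_cancel]
  have r3 {T : H →L[ℂ] H} (hT : T ∈ jNormalProjections J) :
      (1 - jAdjoint J T) * jAdjoint J (1 - jAdjoint J T) * (jAdjoint J T * (1 - T)) = 0 := by
    have : jAdjoint J T * jAdjoint J T = jAdjoint J T := by rw [← jAdjoint_mul hJ, hT.1]
    rw [(one_sub_jAdjoint_mem hJ hT).2, mul_assoc, ← mul_assoc (1 - jAdjoint J T), sub_mul,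
      one_mul, this, sub_self, zero_mul, mul_zero]
  have r4 {T : H →L[ℂ] H} :
      (1 - jAdjoint J T) * jAdjoint J (1 - jAdjoint J T) + jAdjoint J T * (1 - T) = 1 - T := by
    rw [jAdjoint_sub, jAdjoint_one hJ, jAdjoint_jAdjoint hJ, ← add_mul, sub_add_cancel, one_mul]
  have hx := hv.add hf (mul_jAdjoint_mul_mul_one_sub_jAdjoint hJ hQ₀)
    (mul_jAdjoint_mul_mul_one_sub_jAdjoint hJ hQ)
  have hy := hw.add hf' (r3 hQ₀) (r3 hQ)
  rw [r2, r2] at hx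
  rw [r4, r4] at hy
  have hz := hx.add hy (by rw [mul_sub, hQ₀.1, mul_one, sub_self])
    (by rw [mul_sub, hQ.1, mul_one, sub_self])
  rw [add_sub_cancel, add_sub_cancel] at hz
  set U := v + f + (w + J * f * J) with hU
  have hUJ : J * U * J = U := by
    have : J * (J * f * J) * J = f := by
      simp only [mul_assoc, mul_mul_cancel hJ, hJ.mul_self, mul_one]
    simp only [hU, mul_add, add_mul, hvJ, hwJ, this]
    abel
  have hUa : jAdjoint J U = star U := by
    have := congrArg star hUJ
    simpa only [jAdjoint_eq, star_mul, hJ.star_eq, mul_assoc] using this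
  refine ⟨U, ⟨by rw [hUa, hz.mul_star_self], by rw [hUa, hz.star_mul_self]⟩, ?_⟩
  have e1 : U * Q₀ = v + f := by
    have : (w + J * f * J) * Q₀ = 0 := by
      rw [← hy.mul_right, mul_assoc, sub_mul, one_mul, hQ₀.1, sub_self, mul_zero]
    rw [hU, add_mul, this, hx.mul_right, add_zero]
  have e2 : Q * U = v + f := by
    have : Q * (w + J * f * J) = 0 := by
      rw [← hy.mul_left, ← mul_assoc, mul_sub, mul_one, hQ.1, sub_self, zero_mul]
    rw [hU, mul_add, this, hx.mul_left, add_zero]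
  rw [hUa, e1, ← e2, mul_assoc, hz.mul_star_self, mul_one]

/-- The general case reduces to orthogonal projections, which every orbit contains. -/
theorem mem_orbit_of_sameSignature [TopologicalSpace.SeparableSpace H]
    (hJ : IsFundamentalSymmetry J) {Q Q₀ : H →L[ℂ] H} (hQ : Q ∈ jNormalProjections J)
    (hQ₀ : Q₀ ∈ jNormalProjections J) (h : SameSignature J Q.range Q₀.range)
    (hco : SameSignature J (1 - jAdjoint J Q).range (1 - jAdjoint J Q₀).range) :
    Q ∈ orbit J Q₀ := by
  obtain ⟨U, hU, hs⟩ := exists_jUnitary_conj_isSelfAdjoint hJ hQ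
  obtain ⟨U₀, hU₀, hs₀⟩ := exists_jUnitary_conj_isSelfAdjoint hJ hQ₀
  have ho : U * Q * jAdjoint J U ∈ orbit J Q := ⟨U, hU, rfl⟩
  have ho₀ : U₀ * Q₀ * jAdjoint J U₀ ∈ orbit J Q₀ := ⟨U₀, hU₀, rfl⟩
  have hmem := orbit_subset hJ hQ ho
  have hmem₀ := orbit_subset hJ hQ₀ ho₀
  refine mem_orbit_trans hJ (mem_orbit_symm hJ ho) (mem_orbit_trans hJ ?_ ho₀)
  refine mem_orbit_of_star_eq hJ hmem hmem₀ hs hs₀ ?_ ?_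
  · exact (sameSignature_of_mem_orbit hJ hQ ho).trans
      (h.trans (sameSignature_of_mem_orbit hJ hQ₀ ho₀).symm)
  · exact (sameSignature_of_mem_orbit hJ (one_sub_jAdjoint_mem hJ hQ)
      (one_sub_jAdjoint_mem_orbit hJ ho)).trans
      (hco.trans (sameSignature_of_mem_orbit hJ (one_sub_jAdjoint_mem hJ hQ₀)
        (one_sub_jAdjoint_mem_orbit hJ ho₀)).symm)

end Classification

/-! ### Connected components -/

section Component

open Topology Filter

variable {H : Type*} [NormedAddCommGroup H] [InnerProductSpace ℂ H] [CompleteSpace H]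
  {J : H →L[ℂ] H}

/-- The signatures of the range are locally constant on the `J`-normal projections: for `Q` near
`Q₀` an invertible operator near the identity carries the range of `Q₀` and its isotropic part onto
those of `Q`, and preserves the definiteness of the two parts of a signature decomposition. -/
theorem eventually_sameSignature (hJ : IsFundamentalSymmetry J) {Q₀ : H →L[ℂ] H}
    (hQ₀ : Q₀ ∈ jNormalProjections J) :
    ∀ᶠ Q in 𝓝[jNormalProjections J] Q₀, SameSignature J Q.range Q₀.range := by
  obtain ⟨P, N, hd⟩ := exists_isSignatureDecomposition hJ hQ₀
  obtain ⟨c, hc, hP⟩ := hd.isUniformlyPositive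
  obtain ⟨d, hd', hN⟩ := hd.isUniformlyNegative
  have hcont := continuous_jAdjoint J
  -- `W Q` intertwines the projections onto the parts of the range, and `W Q₀ = 1`
  let W : (H →L[ℂ] H) → H →L[ℂ] H := fun Q => Q * jAdjoint J Q * (Q₀ * jAdjoint J Q₀) +
    Q * (1 - jAdjoint J Q) * (Q₀ * (1 - jAdjoint J Q₀)) + (1 - Q) * (1 - Q₀)
  have hW : Continuous W := by fun_prop
  have hEE {Q : H →L[ℂ] H} (hQ : Q ∈ jNormalProjections J) :
      jAdjoint J Q * jAdjoint J Q = jAdjoint J Q := by rw [← jAdjoint_mul hJ, hQ.1]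
  have hQ1 {Q : H →L[ℂ] H} (hQ : Q ∈ jNormalProjections J) : (1 - Q) * (1 - Q) = 1 - Q := by
    simp only [mul_sub, sub_mul, mul_one, one_mul, hQ.1]; abel
  have hW1 : W Q₀ = 1 := by
    simp only [W, mul_one_sub_jAdjoint_mul_self hJ hQ₀, hQ1 hQ₀]
    rw [(Commute.mul_mul_mul_comm (hQ₀.2.symm : Commute (jAdjoint J Q₀) Q₀)), hQ₀.1, hEE hQ₀,
      mul_sub, mul_one]
    abel
  have hunit : ∀ᶠ Q in 𝓝 Q₀, IsUnit (W Q) :=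
    hW.continuousAt.eventually (Units.isOpen.mem_nhds (by rw [hW1]; exact isUnit_one))
  have hsmall : ∀ᶠ Q in 𝓝 Q₀, ‖star (W Q) * J * W Q - J‖ < min c d := by
    have h1 : Continuous fun Q => ‖star (W Q) * J * W Q - J‖ := by fun_prop
    refine h1.continuousAt.eventually (gt_mem_nhds ?_)
    simpa [hW1, hJ.mul_self] using ⟨hc, hd'⟩
  filter_upwards [mem_nhdsWithin_of_mem_nhds hunit, mem_nhdsWithin_of_mem_nhds hsmall,
    self_mem_nhdsWithin] with Q hu hsm hQ
  obtain ⟨V, hWV, hVW⟩ := isUnit_iff_exists.1 hu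
  let e : H ≃L[ℂ] H := ContinuousLinearEquiv.equivOfInverse (W Q) V
    (fun x => congrArg (fun A : H →L[ℂ] H => A x) hVW)
    (fun x => congrArg (fun A : H →L[ℂ] H => A x) hWV)
  have hr : Q.range = Q₀.range.map (e.toLinearEquiv : H →ₗ[ℂ] H) := by
    refine range_eq_map_of_mul_eq e (?_ : W Q * Q₀ = Q * W Q)
    have a1 : (1 - Q₀) * Q₀ = 0 := by rw [sub_mul, hQ₀.1, one_mul, sub_self]
    have a2 : Q * (1 - Q) = 0 := by rw [mul_sub, hQ.1, mul_one, sub_self]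
    simp only [W, mul_add, add_mul, mul_assoc, a1, mul_zero]
    simp only [← mul_assoc, a2, zero_mul, hQ.1]
    simp only [mul_assoc, sub_mul, mul_sub, mul_one, ← hQ₀.2, hQ₀.1]
    simp only [← mul_assoc, hQ₀.1]
  have hi : isotropicPart J Q.range =
      (isotropicPart J Q₀.range).map (e.toLinearEquiv : H →ₗ[ℂ] H) := by
    rw [isotropicPart_range hJ hQ, isotropicPart_range hJ hQ₀]
    refine range_eq_map_of_mul_eq e
      (?_ : W Q * (Q₀ * (1 - jAdjoint J Q₀)) = Q * (1 - jAdjoint J Q) * W Q)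
    have b3 : (1 - Q₀) * (Q₀ * (1 - jAdjoint J Q₀)) = 0 := by
      rw [← mul_assoc, sub_mul, one_mul, hQ₀.1, sub_self, zero_mul]
    have b4 : Q * (1 - jAdjoint J Q) * (1 - Q) = 0 := by
      have : Q * (1 - jAdjoint J Q) = (1 - jAdjoint J Q) * Q := by
        rw [mul_sub, sub_mul, hQ.2, mul_one, one_mul]
      rw [this, mul_assoc, mul_sub, mul_one, hQ.1, sub_self, mul_zero]
    calc W Q * (Q₀ * (1 - jAdjoint J Q₀))
        = Q * (1 - jAdjoint J Q) * (Q₀ * (1 - jAdjoint J Q₀)) := by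
          simp only [W, add_mul]
          rw [mul_assoc (Q * jAdjoint J Q), mul_jAdjoint_mul_mul_one_sub_jAdjoint hJ hQ₀,
            mul_assoc (1 - Q), b3, mul_zero, mul_zero,
            zero_add, add_zero, mul_assoc (Q * (1 - jAdjoint J Q)),
            mul_one_sub_jAdjoint_mul_self hJ hQ₀]
      _ = Q * (1 - jAdjoint J Q) * W Q := by
          simp only [W, mul_add]
          rw [← mul_assoc _ (Q * jAdjoint J Q), mul_one_sub_jAdjoint_mul_mul_jAdjoint hJ hQ,
            zero_mul, ← mul_assoc _ (1 - Q), b4,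
            zero_mul, zero_add, add_zero, ← mul_assoc _ (Q * (1 - jAdjoint J Q)),
            mul_one_sub_jAdjoint_mul_self hJ hQ]
  have hform (x : H) : |(form J (e x) (e x)).re - (form J x x).re| ≤
      ‖star (W Q) * J * W Q - J‖ * ‖x‖ ^ 2 := by
    have h1 : form J (e x) (e x) - form J x x = inner ℂ ((star (W Q) * J * W Q - J) x) x := by
      change inner ℂ (J (W Q x)) (W Q x) - inner ℂ (J x) x = _
      rw [← ContinuousLinearMap.adjoint_inner_left (W Q) x, ← inner_sub_left]
      rfl
    rw [← Complex.sub_re, h1]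
    calc _ ≤ ‖inner ℂ ((star (W Q) * J * W Q - J) x) x‖ := Complex.abs_re_le_norm _
      _ ≤ ‖(star (W Q) * J * W Q - J) x‖ * ‖x‖ := norm_inner_le_norm _ _
      _ ≤ ‖star (W Q) * J * W Q - J‖ * ‖x‖ * ‖x‖ := by
          gcongr; exact ContinuousLinearMap.le_opNorm _ _
      _ = _ := by ring
  have hzero {x : H} {k : ℝ} (hk : 0 < k) (h : k * ‖x‖ ^ 2 ≤ 0) : x = 0 := by
    have h1 : ‖x‖ ^ 2 ≤ 0 := nonpos_of_mul_nonpos_right h hk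
    simpa using le_antisymm h1 (sq_nonneg _)
  obtain ⟨P', N', hd2⟩ := exists_isSignatureDecomposition hJ hQ
  obtain ⟨hpos, hneg⟩ := signature_eq_dim hJ hd2 (P := P.map (e.toLinearEquiv : H →ₗ[ℂ] H))
    (N := N.map (e.toLinearEquiv : H →ₗ[ℂ] H)) (by
      rintro _ ⟨x, hx, rfl⟩ hle
      have h1 := (abs_le.1 (hform x)).1
      have h2 := hP x hx
      have h3 : (form J (e x) (e x)).re ≤ 0 := hle
      have : x = 0 := hzero (sub_pos.2 (hsm.trans_le (min_le_left _ _))) (by linarith)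
      rw [this, map_zero]) (by
      rintro _ ⟨x, hx, rfl⟩ hle
      have h1 := (abs_le.1 (hform x)).2
      have h2 := hN x hx
      have h3 : 0 ≤ (form J (e x) (e x)).re := hle
      have : x = 0 := hzero (sub_pos.2 (hsm.trans_le (min_le_right _ _))) (by linarith)
      rw [this, map_zero]) (by
      rw [hi, ← Submodule.map_sup, ← Submodule.map_sup, hd.sup_eq, hr])
  refine ⟨?_, ?_, ?_⟩
  · rw [hpos, posSignature_eq hJ hd, dim_map]
  · rw [hneg, negSignature_eq hJ hd, dim_map]
  · rw [isotropicSignature, hi, dim_map, isotropicSignature]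

theorem eventually_mem_orbit [TopologicalSpace.SeparableSpace H] (hJ : IsFundamentalSymmetry J)
    {Q₀ : H →L[ℂ] H} (hQ₀ : Q₀ ∈ jNormalProjections J) :
    ∀ᶠ Q in 𝓝[jNormalProjections J] Q₀, Q ∈ orbit J Q₀ := by
  have hcont : Tendsto (fun Q => 1 - jAdjoint J Q) (𝓝[jNormalProjections J] Q₀)
      (𝓝[jNormalProjections J] (1 - jAdjoint J Q₀)) :=
    (continuous_const.sub (continuous_jAdjoint J)).continuousWithinAt.tendsto_nhdsWithin
      fun Q hQ => one_sub_jAdjoint_mem hJ hQ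
  filter_upwards [eventually_sameSignature hJ hQ₀,
    hcont.eventually (eventually_sameSignature hJ (one_sub_jAdjoint_mem hJ hQ₀)),
    self_mem_nhdsWithin] with Q h1 h2 hQ
  exact mem_orbit_of_sameSignature hJ hQ hQ₀ h1 h2

theorem isPreconnected_orbit (hJ : IsFundamentalSymmetry J) (Q₀ : H →L[ℂ] H) :
    IsPreconnected (orbit J Q₀) := by
  refine isPreconnected_of_forall Q₀ ?_
  rintro _ ⟨U, hU, rfl⟩
  obtain ⟨γ, hγ, hmem, h0, h1⟩ := exists_path_jUnitary hJ hU
  have hcont : Continuous fun t => γ t * Q₀ * jAdjoint J (γ t) :=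
    (hγ.mul continuous_const).mul ((continuous_jAdjoint J).comp hγ)
  refine ⟨Set.range fun t => γ t * Q₀ * jAdjoint J (γ t), ?_, ⟨0, ?_⟩, ⟨1, ?_⟩,
    isPreconnected_range hcont⟩
  · rintro _ ⟨t, rfl⟩
    exact ⟨γ t, hmem t, rfl⟩
  · simp only [h0, jAdjoint_one hJ, one_mul, mul_one]
  · simp only [h1]

theorem connectedComponentIn_eq_orbit [TopologicalSpace.SeparableSpace H]
    (hJ : IsFundamentalSymmetry J) {Q₀ : H →L[ℂ] H} (hQ₀ : Q₀ ∈ jNormalProjections J) :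
    connectedComponentIn (jNormalProjections J) Q₀ = orbit J Q₀ := by
  refine Set.Subset.antisymm (fun Q hQ => ?_)
    ((isPreconnected_orbit hJ Q₀).subset_connectedComponentIn (mem_orbit_self hJ Q₀)
      (orbit_subset hJ hQ₀))
  have hsub := connectedComponentIn_subset (jNormalProjections J) Q₀
  refine isPreconnected_connectedComponentIn.induction₂ (fun x y => y ∈ orbit J x) ?_ ?_ ?_
    (mem_connectedComponentIn hQ₀) hQ
  · intro x hx
    exact (eventually_mem_orbit hJ (hsub hx)).filter_mono (nhdsWithin_mono _ hsub)
  · intro x y z _ _ _ hxy hyz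
    exact mem_orbit_trans hJ hyz hxy
  · intro x y _ _ hxy
    exact mem_orbit_symm hJ hxy

end Component

end Krein

theorem mainTheorem4 {H : Type*} [NormedAddCommGroup H] [InnerProductSpace ℂ H] [CompleteSpace H]
    [TopologicalSpace.SeparableSpace H] (J : H →L[ℂ] H) (hJ : Krein.IsFundamentalSymmetry J)
    (Q₀ : H →L[ℂ] H) (hQ₀ : Q₀ ∈ Krein.jNormalProjections J) :
    (∀ Q ∈ Krein.jNormalProjections J,
      (Q ∈ Krein.orbit J Q₀ ↔
        Krein.posSignature J Q.range = Krein.posSignature J Q₀.range ∧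
        Krein.negSignature J Q.range = Krein.negSignature J Q₀.range ∧
        Krein.isotropicSignature J Q.range = Krein.isotropicSignature J Q₀.range ∧
        Krein.posCosignature J Q.range = Krein.posCosignature J Q₀.range ∧
        Krein.negCosignature J Q.range = Krein.negCosignature J Q₀.range)) ∧
    connectedComponentIn (Krein.jNormalProjections J) Q₀ = Krein.orbit J Q₀ := by
  refine ⟨fun Q hQ => ?_, Krein.connectedComponentIn_eq_orbit hJ hQ₀⟩
  rw [Krein.posCosignature, Krein.posCosignature, Krein.negCosignature, Krein.negCosignature,
    Krein.jOrthogonal_range hJ hQ, Krein.jOrthogonal_range hJ hQ₀]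
  constructor
  · intro h
    obtain ⟨h1, h2, h3⟩ := Krein.sameSignature_of_mem_orbit hJ hQ₀ h
    obtain ⟨h4, h5, -⟩ := Krein.sameSignature_of_mem_orbit hJ (Krein.one_sub_jAdjoint_mem hJ hQ₀)
      (Krein.one_sub_jAdjoint_mem_orbit hJ h)
    exact ⟨h1, h2, h3, h4, h5⟩
  · rintro ⟨h1, h2, h3, h4, h5⟩
    refine Krein.mem_orbit_of_sameSignature hJ hQ hQ₀ ⟨h1, h2, h3⟩ ⟨h4, h5, ?_⟩
    rw [Krein.isotropicSignature, Krein.isotropicSignature,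
      Krein.isotropicPart_range_one_sub_jAdjoint hJ hQ,
      Krein.isotropicPart_range_one_sub_jAdjoint hJ hQ₀]
    exact h3
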